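/- Let $n\ge 0$ be an integer, let $\mathfrak{gl}(n)$ be the Lie algebra of complex $n\times n$ matrices, with matrix units $E_{ij}$, and let $\mathfrak{gl}(n)[t]=\mathfrak{gl}(n)\otimes_{\mathbb C}\mathbb{C}[t]$ be its current algebra, with bracket $[x\otimes P,y\otimes Q]=[x,y]\otimes PQ$. Write $x(m)=x\otimes t^m$, and let $$[U(\mathfrak{gl}(n)[t])]^{\mathfrak{gl}(n)}=\{u\in U(\mathfrak{gl}(n)[t]) : [x(0),u]=0 \text{ for all } x\in\mathfrak{gl}(n)\}$$ be the algebra of invariants of the enveloping algebra $U(\mathfrak{gl}(n)[t])$ under the adjoint action of $\mathfrak{gl}(n)=\mathfrak{gl}(n)\otimes 1$. For $k\ge 1$ and integers $n_1,\dots,n_k\ge 0$ put $$\theta_{\sigma_k}(n_1,\dots,n_k)=\sum_{1\le i_1,\dots,i_k\le n}E_{i_1i_2}(n_1)E_{i_2i_3}(n_2)\cdots E_{i_ki_1}(n_k)\in U(\mathfrak{gl}(n)[t]).$$ (1) The unital $\mathbb{C}$-subalgebra of $U(\mathfrak{gl}(n)[t])$ generated by the elements $\theta_{\sigma_k}(n_1,\dots,n_k)$,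 for all $k\ge 1$ and all $n_1,\dots,n_k\ge 0$, is equal to $[U(\mathfrak{gl}(n)[t])]^{\mathfrak{gl}(n)}$. (2) If $n\ge 4$, then the smaller set of those $\theta_{\sigma_k}(n_1,\dots,n_k)$ with $k\ge 1$ and $0\le n_1\le\dots\le n_k$ does not generate the algebra $[U(\mathfrak{gl}(n)[t])]^{\mathfrak{gl}(n)}$. -/

import Mathlib

open Polynomial
open scoped TensorProduct

noncomputable section

/-- The Lie algebra `gl(n)` over `ℂ`: all `n × n` complex matrices. -/
abbrev Gl (n : ℕ) : Type := Matrix (Fin n) (Fin n) ℂ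

/-- The bracket of `gl(n)` is the commutator of matrices. -/
instance instLieRingGl (n : ℕ) : LieRing (Gl n) := LieRing.ofAssociativeRing

/-- The current algebra `gl(n)[t] = gl(n) ⊗ ℂ[t]`, with bracket
`[x ⊗ P, y ⊗ Q] = [x, y] ⊗ PQ` (the polynomial is written as the left tensor factor). -/
abbrev CurrentGl (n : ℕ) : Type := ℂ[X] ⊗[ℂ] Gl n

/-- The enveloping algebra `U(gl(n)[t])`. -/
abbrev UCurrentGl (n : ℕ) : Type := UniversalEnvelopingAlgebra ℂ (CurrentGl n)

/-- The element `x(P) = x ⊗ P` of `gl(n)[t]`, viewed in `U(gl(n)[t])`. -/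
def currentElt {n : ℕ} (x : Gl n) (P : ℂ[X]) : UCurrentGl n :=
  UniversalEnvelopingAlgebra.ι ℂ (P ⊗ₜ[ℂ] x : CurrentGl n)

/-- `[U(gl(n)[t])]^{gl(n)}`: the subalgebra of invariants for the adjoint action of
`gl(n) = gl(n) ⊗ 1`, i.e. of all `u` with `[x(1), u] = 0` for every `x ∈ gl(n)`. -/
def glInvariants (n : ℕ) : Subalgebra ℂ (UCurrentGl n) where
  carrier := {u | ∀ x : Gl n, ⁅currentElt x 1, u⁆ = 0}
  mul_mem' {u v} hu hv x := by
    have h1 := sub_eq_zero.mp (hu x)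
    have h2 := sub_eq_zero.mp (hv x)
    refine sub_eq_zero.mpr ?_
    rw [← mul_assoc, h1, mul_assoc, h2, mul_assoc]
  add_mem' {u v} hu hv x := by
    have h1 := sub_eq_zero.mp (hu x)
    have h2 := sub_eq_zero.mp (hv x)
    refine sub_eq_zero.mpr ?_
    rw [mul_add, add_mul, h1, h2]
  algebraMap_mem' c x := sub_eq_zero.mpr (Algebra.commutes c _).symm

/-- The cycle element
`θ_{σ_k}(m_1, …, m_k) = ∑ E_{i_1 i_2}(m_1) E_{i_2 i_3}(m_2) ⋯ E_{i_k i_1}(m_k)` of `U(gl(n)[t])`,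
the sum being over all `i_1, …, i_k ∈ {1, …, n}`, where `E_{ij}(m) = E_{ij} ⊗ t ^ m` and the
factors are multiplied in the written order.
`finRotate k` is the `k`-cycle `σ_k = (1, 2, …, k)`. -/
def cycleElt (n : ℕ) {k : ℕ} (m : Fin k → ℕ) : UCurrentGl n :=
  ∑ i : Fin k → Fin n,
    (List.ofFn fun j : Fin k =>
      currentElt (Matrix.single (i j) (i (finRotate k j)) (1 : ℂ)) (X ^ m j)).prod

end

/-! Generation. Coefficients turn endomorphisms of tensor powers of `ℂⁿ` into elements of
`U(gl(n)[t])`, and the adjoint action of `gl(n)` becomes the commutator with the diagonal action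
(`lie_tensorElt`). The diagonal operators are closed under conjugate transpose. Subtracting the
orthogonal projection onto the kernel of the coefficient map therefore lifts an invariant of `U` to
an endomorphism commuting with `gl(n)` (`exists_commute_lift`); no PBW theorem is needed. By the
first fundamental theorem (`mem_span_placePerm`), obtained from a double centralizer argument, such
an endomorphism is a combination of place permutations. So invariants of length at most `k` are
spanned by elements attached to permutations of at most `k` letters. Up to shorter invariants, such
an element is the product of a cycle element and the element of a permutation on fewer letters, and
induction on the length concludes.

Failure for sorted powers. Let `gl(n)[t]/(t²)` act on polynomials in two matrices `x` and `b`: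
`E_{ij}(0)` by derivations (left multiplication on `x`, conjugation on `b`), `E_{ij}(1)` as
multiplication by `b_{ij}`. A cycle element acts as the trace of a product of the operator matrices
`E` and `B`, or as zero. Sorted powers give only `tr (Eᵃ Bᵇ)`, whereas `θ(0,1,0,1)` gives `tr (E B E
B)`. Apply these to a highest weight vector `v`, the `s`-th power of the product of leading minors
of `x`. On `v` the central elements `tr Eᵃ` are scalars, `E` satisfies a characteristic identity of
degree `n`, and the operators `tr (Eᵃ B)` commute with one another
(`IsAdjointTensor.commute_trace_pow_mul`). In degree two in `b`, the sorted algebra thus reaches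
only the span of `tr (Eᵃ B) tr (Eᶜ B) v` with `a ≤ c < n` and `tr (Eᵏ B²) v` with `k < n`.

If `θ(0,1,0,1)` were in the sorted algebra, `tr (E B E B) v` would lie in that span for every `s`.
After rescaling, as `s → ∞`, the values at `x = 1`, `b = β` tend to `tr (Dᵃβ) tr (Dᶜβ)`, `tr (Dᵏβ²)`
and `tr (DβDβ)`, with `D` diagonal with distinct entries. For `n ≥ 4` these functions of `β` are
linearly independent (`linearIndependent_classicalVec`). Independence is an open condition, so it
holds for some finite `s`, a contradiction. -/

noncomputable section


/-! ### Commutants of the diagonal action of `gl(n)` on tensor powers -/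

section TensorPower

set_option linter.unusedSectionVars false

open Equiv

variable {κ ν : Type*} [Fintype κ] [DecidableEq κ] [Fintype ν] [DecidableEq ν]

/-- The matrix of the tensor product `⊗ₐ yₐ` of a family of matrices. -/
def tensorMatrix (y : κ → Matrix ν ν ℂ) : Matrix (κ → ν) (κ → ν) ℂ :=
  fun i j => ∏ a, y a (i a) (j a)

/-- The matrix of the place permutation attached to `σ`. -/
def placePerm (ν : Type*) [DecidableEq ν] (σ : Perm κ) : Matrix (κ → ν) (κ → ν) ℂ :=
  fun i j => if j = i ∘ σ then 1 else 0

/-- The matrix of `x` acting diagonally on a tensor power: the sum of its actions on the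
factors. -/
def diagAction (κ : Type*) [Fintype κ] [DecidableEq κ] (x : Matrix ν ν ℂ) :
    Matrix (κ → ν) (κ → ν) ℂ :=
  ∑ a : κ, tensorMatrix (Pi.mulSingle a x : κ → Matrix ν ν ℂ)

lemma tensorMatrix_mul (y z : κ → Matrix ν ν ℂ) :
    tensorMatrix y * tensorMatrix z = tensorMatrix (y * z) := by
  ext i j
  simp only [Matrix.mul_apply, tensorMatrix, Pi.mul_apply, ← Finset.prod_mul_distrib]
  rw [Finset.prod_univ_sum]
  simp

lemma placePerm_mul_apply (σ : Perm κ) (T : Matrix (κ → ν) (κ → ν) ℂ) (i j : κ → ν) :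
    (placePerm ν σ * T) i j = T (i ∘ σ) j := by
  simp [Matrix.mul_apply, placePerm]

lemma mul_placePerm_apply (σ : Perm κ) (T : Matrix (κ → ν) (κ → ν) ℂ) (i j : κ → ν) :
    (T * placePerm ν σ) i j = T i (j ∘ σ.symm) := by
  have h (l : κ → ν) : j = l ∘ σ ↔ l = j ∘ σ.symm :=
    ⟨fun h => by rw [h]; ext; simp, fun h => by rw [h]; ext; simp⟩
  simp [Matrix.mul_apply, placePerm, h]

lemma placePerm_one : placePerm ν (1 : Perm κ) = 1 := by
  ext i j
  simp [placePerm, Matrix.one_apply, eq_comm]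

lemma placePerm_mul (σ τ : Perm κ) :
    placePerm ν σ * placePerm ν τ = placePerm ν (σ * τ) := by
  ext i j
  rw [placePerm_mul_apply]
  rfl

lemma placePerm_mul_inv (σ : Perm κ) : placePerm ν σ * placePerm ν σ⁻¹ = 1 := by
  rw [placePerm_mul, mul_inv_cancel, placePerm_one]

lemma placePerm_inv_mul (σ : Perm κ) : placePerm ν σ⁻¹ * placePerm ν σ = 1 := by
  rw [placePerm_mul, inv_mul_cancel, placePerm_one]

lemma placePerm_conjTranspose (σ : Perm κ) : (placePerm ν σ).conjTranspose = placePerm ν σ⁻¹ := by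
  ext i j
  have h : i = j ∘ σ ↔ j = i ∘ (σ⁻¹ : Perm κ) :=
    ⟨fun h => by rw [h]; ext; simp, fun h => by rw [h]; ext; simp⟩
  simp only [Matrix.conjTranspose_apply, placePerm, h]
  split_ifs <;> simp

lemma placePerm_conj_apply (σ : Perm κ) (T : Matrix (κ → ν) (κ → ν) ℂ) (i j : κ → ν) :
    (placePerm ν σ * T * placePerm ν σ⁻¹) i j = T (i ∘ σ) (j ∘ σ) := by
  rw [mul_placePerm_apply, placePerm_mul_apply]
  rfl

lemma placePerm_conj_tensorMatrix (σ : Perm κ) (y : κ → Matrix ν ν ℂ) :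
    placePerm ν σ * tensorMatrix y * placePerm ν σ⁻¹ = tensorMatrix (y ∘ σ.symm) := by
  ext i j
  rw [placePerm_conj_apply]
  simp only [tensorMatrix, Function.comp_apply]
  exact Fintype.prod_equiv σ _ _ fun a => by simp

lemma mulSingle_comp_perm (σ : Perm κ) (a : κ) (x : Matrix ν ν ℂ) :
    (Pi.mulSingle (σ a) x : κ → Matrix ν ν ℂ) ∘ σ = Pi.mulSingle a x := by
  ext b : 1
  by_cases h : b = a
  · subst h; simp
  · simp [Pi.mulSingle_eq_of_ne h, Pi.mulSingle_eq_of_ne (σ.injective.ne h)]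

lemma commute_diagAction_placePerm (σ : Perm κ) (x : Matrix ν ν ℂ) :
    Commute (diagAction κ x) (placePerm ν σ) := by
  have h : placePerm ν σ * diagAction κ x * placePerm ν σ⁻¹ = diagAction κ x := by
    simp only [diagAction, Finset.mul_sum, Finset.sum_mul, placePerm_conj_tensorMatrix]
    refine Fintype.sum_equiv σ _ _ fun a => ?_
    rw [← mulSingle_comp_perm σ a x, Function.comp_assoc]
    simp
  calc diagAction κ x * placePerm ν σ
      = (placePerm ν σ * diagAction κ x * placePerm ν σ⁻¹) * placePerm ν σ := by rw [h]
    _ = placePerm ν σ * diagAction κ x := by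
      rw [mul_assoc, placePerm_inv_mul, mul_one]

/-- The diagonal action inserts `x` at every place in turn, so reindexing the places by `σ` moves
the insertion inside the symmetrization. This recursion lets symmetrized tensors be built from
diagonal operators alone. -/
lemma sum_tensorMatrix_comp_mul_diagAction (y : κ → Matrix ν ν ℂ) (x : Matrix ν ν ℂ) :
    (∑ σ : Perm κ, tensorMatrix (y ∘ σ)) * diagAction κ x =
      ∑ d : κ, ∑ σ : Perm κ, tensorMatrix ((y * (Pi.mulSingle d x : κ → Matrix ν ν ℂ)) ∘ σ) := by
  rw [Finset.sum_comm, Finset.sum_mul]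
  refine Finset.sum_congr rfl fun σ _ => ?_
  rw [diagAction, Finset.mul_sum]
  refine Fintype.sum_equiv σ _ _ fun a => ?_
  rw [tensorMatrix_mul, ← mulSingle_comp_perm σ a x]
  rfl

/-- Symmetrized tensors commute with everything that commutes with the diagonal action. -/
lemma sum_tensorMatrix_comp_mem_centralizer {T : Matrix (κ → ν) (κ → ν) ℂ}
    (hT : ∀ x : Matrix ν ν ℂ, Commute T (diagAction κ x)) (s : Finset κ) :
    ∀ y : κ → Matrix ν ν ℂ, (∀ a ∉ s, y a = 1) →
      ∑ σ : Perm κ, tensorMatrix (y ∘ σ) ∈ Subalgebra.centralizer ℂ {T} := by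
  induction s using Finset.induction_on with
  | empty =>
    intro y hy
    have : y = 1 := funext fun a => hy a (Finset.notMem_empty a)
    subst this
    have h1 : tensorMatrix (1 : κ → Matrix ν ν ℂ) = 1 := by
      ext i j
      simp only [tensorMatrix, Pi.one_apply, Matrix.one_apply, Finset.prod_ite_zero, funext_iff]
      simp
    have h2 (σ : Perm κ) : (1 : κ → Matrix ν ν ℂ) ∘ σ = 1 := rfl
    simp only [h2, h1]
    exact sum_mem fun _ _ => one_mem _
  | insert c s hc ih =>
    intro y hy
    -- Remove the entry at `c`, then multiply the symmetrization of `y'` by the diagonal action of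
    -- that entry. Insertion at a place outside `s`, where `y'` is `1`, gives the symmetrization of
    -- `y` again; insertion inside `s` is covered by induction. The coefficient of the wanted term
    -- is the size of `sᶜ`, nonzero because `c ∉ s`.
    set y' := Function.update y c 1 with hy'
    obtain ⟨x, hx⟩ : ∃ x, x = y c := ⟨_, rfl⟩
    have hs (a : κ) (ha : a ∉ s) : y' a = 1 := by
      by_cases h : a = c
      · subst h; simp [hy']
      · simp [hy', h, hy a (by simp [h, ha])]
    have hmul : y' * (Pi.mulSingle c x : κ → Matrix ν ν ℂ) = y := by
      ext a : 1
      by_cases h : a = c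
      · subst h; simp [hy', hx]
      · simp [hy', h]
    have hout (d : κ) (hd : d ∉ s) :
        ∑ σ : Perm κ, tensorMatrix ((y' * (Pi.mulSingle d x : κ → Matrix ν ν ℂ)) ∘ σ) =
          ∑ σ : Perm κ, tensorMatrix (y ∘ σ) := by
      refine (Fintype.sum_equiv (Equiv.mulLeft (swap c d)) _ _ fun σ => ?_).symm
      congr 1
      rw [← hmul]
      ext a : 1
      simp only [Function.comp_apply, Equiv.coe_mulLeft, Perm.coe_mul, Pi.mul_apply]
      generalize σ a = b
      by_cases h1 : b = c
      · subst h1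
        · by_cases h : b = d
          · subst h; rw [swap_self]; simp
          · simp [hs d hd, hs b hc]
      · by_cases h2 : b = d
        · subst h2
          simp [hs b hd, hs c hc, Pi.mulSingle_eq_of_ne h1, Pi.mulSingle_eq_of_ne (Ne.symm h1)]
        · rw [swap_apply_of_ne_of_ne h1 h2]
          simp [Pi.mulSingle_eq_of_ne h1, Pi.mulSingle_eq_of_ne h2]
    have hD : diagAction κ x ∈ Subalgebra.centralizer ℂ {T} := by
      rw [Subalgebra.mem_centralizer_iff]
      rintro _ rfl
      exact hT _
    have hin (d : κ) (hd : d ∈ s) :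
        ∑ σ : Perm κ, tensorMatrix ((y' * (Pi.mulSingle d x : κ → Matrix ν ν ℂ)) ∘ σ) ∈
          Subalgebra.centralizer ℂ {T} := by
      refine ih _ fun a ha => ?_
      have : a ≠ d := fun h => ha (h ▸ hd)
      simp [hs a ha, Pi.mulSingle_eq_of_ne this]
    have hsum := sum_tensorMatrix_comp_mul_diagAction y' x
    rw [← Finset.sum_add_sum_compl s, Finset.sum_congr rfl (s₁ := sᶜ)
      fun d hd => hout d (Finset.mem_compl.mp hd), Finset.sum_const, ← sub_eq_iff_eq_add'] at hsum
    have hmem : (sᶜ.card : ℂ) • ∑ σ : Perm κ, tensorMatrix (y ∘ σ) ∈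
        Subalgebra.centralizer ℂ {T} := by
      rw [Nat.cast_smul_eq_nsmul, ← hsum]
      exact sub_mem (mul_mem (ih y' hs) hD) (sum_mem hin)
    have hne : (sᶜ.card : ℂ) ≠ 0 := by
      rw [Nat.cast_ne_zero, Finset.card_ne_zero]
      exact ⟨c, Finset.mem_compl.mpr hc⟩
    simpa [smul_smul, inv_mul_cancel₀ hne] using Subalgebra.smul_mem _ hmem (sᶜ.card : ℂ)⁻¹

lemma single_eq_tensorMatrix (i j : κ → ν) :
    Matrix.single i j (1 : ℂ) = tensorMatrix fun a => Matrix.single (i a) (j a) 1 := by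
  ext k l
  simp only [tensorMatrix, Matrix.single_apply, Finset.prod_ite_zero]
  simp [funext_iff, forall_and]

/-- Whatever commutes with the diagonal action of `gl` commutes with the commutant of the place
permutations. -/
lemma commute_of_commute_placePerm {T R : Matrix (κ → ν) (κ → ν) ℂ}
    (hT : ∀ x : Matrix ν ν ℂ, Commute T (diagAction κ x))
    (hR : ∀ σ : Perm κ, Commute R (placePerm ν σ)) : Commute T R := by
  -- `R` equals its average over conjugation by place permutations. Expanding it in matrix units,
  -- which are elementary tensors, makes it a combination of symmetrized tensors.
  have key : (Fintype.card (Perm κ) : ℂ) • R = ∑ i, ∑ j, R i j •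
      ∑ σ : Perm κ, tensorMatrix ((fun a => Matrix.single (i a) (j a) (1 : ℂ)) ∘ σ) := by
    calc (Fintype.card (Perm κ) : ℂ) • R
        = ∑ σ : Perm κ, placePerm ν σ⁻¹ * R * placePerm ν σ⁻¹⁻¹ := by
          rw [Finset.sum_congr rfl fun σ _ => ?_, Finset.sum_const, Finset.card_univ,
            Nat.cast_smul_eq_nsmul]
          rw [← (hR _).eq, mul_assoc, placePerm_mul_inv, mul_one]
      _ = _ := by
          conv_lhs => rw [Matrix.matrix_eq_sum_single R]
          simp only [Finset.mul_sum, Finset.sum_mul]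
          rw [Finset.sum_comm]
          refine Finset.sum_congr rfl fun i _ => ?_
          rw [Finset.sum_comm]
          refine Finset.sum_congr rfl fun j _ => ?_
          rw [Finset.smul_sum]
          refine Finset.sum_congr rfl fun σ _ => ?_
          have : Matrix.single i j (R i j) = R i j • Matrix.single i j (1 : ℂ) := by simp
          rw [this, single_eq_tensorMatrix, Matrix.mul_smul, Matrix.smul_mul,
            placePerm_conj_tensorMatrix]
          rfl
  have hmem : (Fintype.card (Perm κ) : ℂ) • R ∈ Subalgebra.centralizer ℂ {T} := by
    rw [key]
    exact sum_mem fun i _ => sum_mem fun j _ => Subalgebra.smul_mem _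
      (sum_tensorMatrix_comp_mem_centralizer hT Finset.univ _ (by simp)) _
  have hne : (Fintype.card (Perm κ) : ℂ) ≠ 0 := Nat.cast_ne_zero.mpr Fintype.card_ne_zero
  have hR' := Subalgebra.smul_mem _ hmem (Fintype.card (Perm κ) : ℂ)⁻¹
  rw [smul_smul, inv_mul_cancel₀ hne, one_smul, Subalgebra.mem_centralizer_iff] at hR'
  exact hR' T rfl

end TensorPower


/-! ### Orthogonal projections on spaces of matrices -/

section MatrixProjection

open Matrix
open scoped ComplexOrder

variable {I : Type*} [Fintype I]

/-- Orthogonal projection onto a subspace of matrices for the Hermitian form `tr (Sᴴ T)`. -/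
lemma exists_matrix_projection (K : Submodule ℂ (Matrix I I ℂ)) :
    ∃ p : Matrix I I ℂ →ₗ[ℂ] Matrix I I ℂ, (∀ T, p T ∈ K) ∧
      ∀ T, ∀ S ∈ K, (Sᴴ * (T - p T)).trace = 0 := by
  let e : Matrix I I ℂ ≃ₗ[ℂ] EuclideanSpace ℂ (I × I) :=
    { toFun := fun T => WithLp.toLp 2 fun q => T q.1 q.2
      invFun := fun v => Matrix.of fun i j => v (i, j)
      map_add' := fun _ _ => rfl
      map_smul' := fun _ _ => rfl
      left_inv := fun _ => rfl
      right_inv := fun _ => rfl }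
  have he (S T : Matrix I I ℂ) : inner ℂ (e S) (e T) = (Sᴴ * T).trace := by
    simp only [PiLp.inner_apply, Fintype.sum_prod_type, Matrix.trace, Matrix.diag_apply,
      Matrix.mul_apply, Matrix.conjTranspose_apply]
    rw [Finset.sum_comm]
    refine Finset.sum_congr rfl fun i _ => Finset.sum_congr rfl fun j _ => ?_
    exact mul_comm _ _
  let K' := K.map (e : Matrix I I ℂ →ₗ[ℂ] EuclideanSpace ℂ (I × I))
  refine ⟨e.symm ∘ₗ (K'.starProjection : EuclideanSpace ℂ (I × I) →ₗ[ℂ] EuclideanSpace ℂ (I × I)) ∘ₗ e, fun T => ?_,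
    fun T S hS => ?_⟩
  · obtain ⟨S, hS, hS'⟩ := K'.starProjection_apply_mem (e T)
    have : e.symm (K'.starProjection (e T)) = S := by rw [← hS']; simp
    simpa [this] using hS
  · rw [← he]
    simp only [LinearMap.comp_apply, map_sub, LinearEquiv.coe_coe, LinearEquiv.apply_symm_apply]
    exact (K'.sub_starProjection_mem_orthogonal (e T)) _ ⟨S, hS, rfl⟩

/-- A finite-dimensional double centralizer theorem: a matrix commuting with the commutant of a
`*`-closed multiplicative family lies in the span of the family. -/
lemma mem_span_of_commute_commutant [DecidableEq I] {G : Type*} [Group G] (P : G →* Matrix I I ℂ)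
    (hP : ∀ g, (P g)ᴴ = P g⁻¹) {T : Matrix I I ℂ}
    (hT : ∀ R : Matrix I I ℂ, (∀ g, Commute R (P g)) → Commute T R) :
    T ∈ Submodule.span ℂ (Set.range P) := by
  set K := Submodule.span ℂ (Set.range P)
  obtain ⟨p, hpK, hp⟩ := exists_matrix_projection K
  have hmulK (g : G) (S : Matrix I I ℂ) (hS : S ∈ K) : P g * S ∈ K := by
    induction hS using Submodule.span_induction with
    | mem x hx => obtain ⟨h, rfl⟩ := hx; exact Submodule.subset_span ⟨g * h, map_mul P g h⟩
    | zero => simp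
    | add x y _ _ hx hy => rw [mul_add]; exact add_mem hx hy
    | smul c x _ hx => rw [Matrix.mul_smul]; exact Submodule.smul_mem _ _ hx
  have huniq (Y Z : Matrix I I ℂ) (hZ : Z ∈ K) (h : ∀ S ∈ K, (Sᴴ * (Y - Z)).trace = 0) :
      p Y = Z := by
    have hmem : p Y - Z ∈ K := sub_mem (hpK Y) hZ
    have h0 : ((p Y - Z)ᴴ * (p Y - Z)).trace = 0 := by
      have h1 := h _ hmem
      have h2 := hp Y _ hmem
      have h3 : p Y - Z = (Y - Z) - (Y - p Y) := by abel
      conv_lhs => rw [h3, mul_sub, ← h3]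
      rw [Matrix.trace_sub, h1, h2, sub_zero]
    exact sub_eq_zero.mp (Matrix.trace_conjTranspose_mul_self_eq_zero_iff.mp h0)
  -- Since `(P g)ᴴ = P g⁻¹` preserves `K`, it also preserves orthogonality to `K`, so the projection
  -- commutes with left multiplication by `P g`.
  have hlin (g : G) (Y : Matrix I I ℂ) : p (P g * Y) = P g * p Y := by
    refine huniq _ _ (hmulK g _ (hpK Y)) fun S hS => ?_
    have h1 := hp Y _ (hmulK g⁻¹ S hS)
    rwa [Matrix.conjTranspose_mul, hP, inv_inv, mul_assoc, mul_sub] at h1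
  -- Column `b` of `p Y` depends linearly on column `a` of `Y` for each `a`; `R a b` is the matrix
  -- of that dependence. Linearity over the `P g` puts every `R a b` in the commutant, so `T`
  -- commutes with them all, `p` is linear over `T`, and `T = T * p 1 = p T` lies in `K`.
  let R (a b : I) : Matrix I I ℂ := .of fun i j => p (Matrix.single j a 1) i b
  have hpR (Y : Matrix I I ℂ) (i b : I) : p Y i b = ∑ a, (R a b * Y) i a := by
    conv_lhs => rw [Matrix.matrix_eq_sum_single Y]
    simp only [map_sum, Matrix.sum_apply, Matrix.mul_apply (M := R _ _), R, Matrix.of_apply]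
    rw [Finset.sum_comm]
    refine Finset.sum_congr rfl fun a _ => Finset.sum_congr rfl fun j _ => ?_
    have : Matrix.single j a (Y j a) = Y j a • Matrix.single j a (1 : ℂ) := by simp
    rw [this, map_smul, Matrix.smul_apply, smul_eq_mul, mul_comm]
  have hRP (a b : I) (g : G) : Commute (R a b) (P g) := by
    ext i j
    have h1 : p (P g * Matrix.single j a 1) i b = (R a b * P g) i j := by
      rw [hpR, Finset.sum_eq_single a]
      · rw [← mul_assoc]; simp
      · intro c _ hc
        rw [← mul_assoc, Matrix.mul_single_apply_of_ne _ _ _ _ _ hc]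
      · simp
    rw [← h1, hlin, Matrix.mul_apply, Matrix.mul_apply]
    rfl
  have hpT (Y : Matrix I I ℂ) : p (T * Y) = T * p Y := by
    ext i b
    simp only [hpR, Matrix.mul_apply (M := T), Finset.mul_sum]
    rw [Finset.sum_comm]
    refine Finset.sum_congr rfl fun a _ => ?_
    rw [← mul_assoc, ← (hT (R a b) fun g => hRP a b g).eq, mul_assoc, Matrix.mul_apply]
  have hone : p 1 = 1 := huniq _ _ (Submodule.subset_span ⟨1, map_one P⟩) (by simp)
  have := hpK T
  rwa [← mul_one T, hpT, hone, mul_one] at this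

/-- Lifting invariants along a linear map that is equivariant for commutators with a `*`-closed
family of matrices. -/
lemma exists_commute_lift {W : Type*} [AddCommGroup W] [Module ℂ W]
    (φ : Matrix I I ℂ →ₗ[ℂ] W) (𝒟 : Set (Matrix I I ℂ)) (h𝒟 : ∀ D ∈ 𝒟, Dᴴ ∈ 𝒟)
    (hφ : ∀ D ∈ 𝒟, ∀ S, φ S = 0 → φ (D * S - S * D) = 0)
    {T : Matrix I I ℂ} (hT : ∀ D ∈ 𝒟, φ (D * T - T * D) = 0) :
    ∃ T', φ T' = φ T ∧ ∀ D ∈ 𝒟, Commute T' D := by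
  obtain ⟨p, hpK, hp⟩ := exists_matrix_projection (LinearMap.ker φ)
  refine ⟨T - p T, by rw [map_sub, LinearMap.mem_ker.mp (hpK T), sub_zero], fun D hD => ?_⟩
  -- The commutator of `D` and `T'` lies in the kernel of `φ`, because the kernel is stable under
  -- commutation with `D`. It is also orthogonal to the kernel, because the kernel is stable under
  -- commutation with `Dᴴ`. Hence it vanishes.
  set T' := T - p T
  have h1 : φ (D * T' - T' * D) = 0 := by
    have : D * T' - T' * D = (D * T - T * D) - (D * p T - p T * D) := by
      simp only [T', mul_sub, sub_mul]; abel
    rw [this, map_sub, hT D hD, hφ D hD _ (hpK T), sub_zero]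
  have h2 (S) (hS : φ S = 0) : (Sᴴ * (D * T' - T' * D)).trace = 0 := by
    have h3 := hp T _ (hφ Dᴴ (h𝒟 D hD) S hS)
    rw [Matrix.conjTranspose_sub, Matrix.conjTranspose_mul, Matrix.conjTranspose_mul,
      Matrix.conjTranspose_conjTranspose, sub_mul, Matrix.trace_sub] at h3
    rw [mul_sub, Matrix.trace_sub, ← mul_assoc, ← mul_assoc, Matrix.trace_mul_cycle Sᴴ T' D]
    exact h3
  have h4 := Matrix.trace_conjTranspose_mul_self_eq_zero_iff.mp (h2 _ h1)
  exact (sub_eq_zero.mp h4).symm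

end MatrixProjection

/-! ### The first fundamental theorem for `gl`. -/

section TensorPower

variable {κ ν : Type*} [Fintype κ] [DecidableEq κ] [DecidableEq ν]

/-- **First fundamental theorem** for `gl`, matrix form: an endomorphism of a tensor power which
commutes with the diagonal action is a combination of place permutations. -/
lemma mem_span_placePerm [Fintype ν] {T : Matrix (κ → ν) (κ → ν) ℂ}
    (hT : ∀ x : Matrix ν ν ℂ, Commute T (diagAction κ x)) :
    T ∈ Submodule.span ℂ (Set.range (placePerm (κ := κ) ν)) := by
  let P : Equiv.Perm κ →* Matrix (κ → ν) (κ → ν) ℂ :=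
    { toFun := placePerm ν
      map_one' := placePerm_one
      map_mul' := fun σ τ => (placePerm_mul σ τ).symm }
  exact mem_span_of_commute_commutant P (fun σ => placePerm_conjTranspose σ)
    fun R hR => commute_of_commute_placePerm hT hR

lemma diagAction_conjTranspose (x : Matrix ν ν ℂ) :
    (diagAction κ x).conjTranspose = diagAction κ x.conjTranspose := by
  rw [diagAction, diagAction, Matrix.conjTranspose_sum]
  refine Finset.sum_congr rfl fun a _ => ?_
  ext i j
  simp only [Matrix.conjTranspose_apply, tensorMatrix, star_prod]
  refine Finset.prod_congr rfl fun b _ => ?_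
  by_cases h : b = a
  · subst h; simp
  · simp [Pi.mulSingle_eq_of_ne h, Matrix.one_apply, eq_comm, apply_ite]

end TensorPower


/-! ### Invariants of the enveloping algebra of the current algebra -/

section Invariants

attribute [local instance 100] LieRing.ofAssociativeRing

variable {n : ℕ}

/-- `currentElt` as a linear map in its matrix argument. -/
def currentHom (n m : ℕ) : Gl n →ₗ[ℂ] UCurrentGl n :=
  (UniversalEnvelopingAlgebra.ι ℂ : CurrentGl n →ₗ⁅ℂ⁆ UCurrentGl n).toLinearMap ∘ₗ
    TensorProduct.mk ℂ ℂ[X] (Gl n) (X ^ m)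

lemma currentHom_apply (m : ℕ) (x : Gl n) : currentHom n m x = currentElt x (X ^ m) := rfl

lemma lie_currentElt (x y : Gl n) (P Q : ℂ[X]) :
    ⁅currentElt x P, currentElt y Q⁆ = currentElt ⁅x, y⁆ (P * Q) := by
  unfold currentElt
  rw [← LieHom.map_lie, LieAlgebra.ExtendScalars.bracket_tmul]

/-- The generator `E_{ij}(m)` of the enveloping algebra. -/
def unitElt (i j : Fin n) (m : ℕ) : UCurrentGl n :=
  currentElt (Matrix.single i j (1 : ℂ)) (X ^ m)

/-- The product of the generators listed in a word. -/
def wordElt (l : List (Fin n × Fin n × ℕ)) : UCurrentGl n :=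
  (l.map fun q => unitElt q.1 q.2.1 q.2.2).prod

/-- The span of the words of length at most `k`. -/
def lenFilt (n k : ℕ) : Submodule ℂ (UCurrentGl n) :=
  Submodule.span ℂ {u | ∃ l : List (Fin n × Fin n × ℕ), l.length ≤ k ∧ u = wordElt l}

lemma wordElt_mem {l : List (Fin n × Fin n × ℕ)} {k : ℕ} (h : l.length ≤ k) :
    wordElt l ∈ lenFilt n k := Submodule.subset_span ⟨l, h, rfl⟩

lemma lenFilt_mono {k k' : ℕ} (h : k ≤ k') : lenFilt n k ≤ lenFilt n k' := by
  refine Submodule.span_mono ?_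
  rintro u ⟨l, hl, rfl⟩
  exact ⟨l, hl.trans h, rfl⟩

lemma mul_mem_lenFilt {k k' : ℕ} {u v : UCurrentGl n} (hu : u ∈ lenFilt n k)
    (hv : v ∈ lenFilt n k') : u * v ∈ lenFilt n (k + k') := by
  have h := Submodule.mul_mem_mul hu hv
  rw [lenFilt, lenFilt, Submodule.span_mul_span] at h
  refine Submodule.span_mono ?_ h
  rintro _ ⟨_, ⟨l, hl, rfl⟩, _, ⟨l', hl', rfl⟩, rfl⟩
  exact ⟨l ++ l', by simp; lia, by simp [wordElt]⟩

lemma currentHom_eq_sum (m : ℕ) (x : Gl n) :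
    currentHom n m x = ∑ i, ∑ j, x i j • unitElt i j m := by
  conv_lhs => rw [Matrix.matrix_eq_sum_single x]
  simp only [map_sum]
  refine Finset.sum_congr rfl fun i _ => Finset.sum_congr rfl fun j _ => ?_
  have : Matrix.single i j (x i j) = x i j • Matrix.single i j (1 : ℂ) := by simp
  rw [this, map_smul]
  rfl

lemma unitElt_mem (i j : Fin n) (m : ℕ) : unitElt i j m ∈ lenFilt n 1 :=
  Submodule.subset_span ⟨[(i, j, m)], by simp, by simp [wordElt]⟩

lemma currentHom_mem (m : ℕ) (x : Gl n) : currentHom n m x ∈ lenFilt n 1 := by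
  rw [currentHom_eq_sum]
  exact sum_mem fun i _ => sum_mem fun j _ => Submodule.smul_mem _ _ (unitElt_mem i j m)

lemma ι_mem_lenFilt (x : CurrentGl n) : UniversalEnvelopingAlgebra.ι ℂ x ∈ lenFilt n 1 := by
  induction x using TensorProduct.induction_on with
  | zero => simp
  | add x y hx hy => rw [map_add]; exact add_mem hx hy
  | tmul P x =>
    induction P using Polynomial.induction_on' with
    | add P Q hP hQ => rw [TensorProduct.add_tmul, map_add]; exact add_mem hP hQ
    | monomial m c =>
      rw [← Polynomial.C_mul_X_pow_eq_monomial, ← Polynomial.smul_eq_C_mul,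
        ← TensorProduct.smul_tmul', map_smul]
      exact Submodule.smul_mem _ _ (currentHom_mem m x)

/-- The elements of finite length form a subalgebra containing the image of `ι`. By the universal
property, the lift of `ι` to this subalgebra followed by the inclusion is the identity, so the
subalgebra is everything. -/
lemma exists_mem_lenFilt (u : UCurrentGl n) : ∃ k, u ∈ lenFilt n k := by
  let A : Subalgebra ℂ (UCurrentGl n) :=
    { carrier := {u | ∃ k, u ∈ lenFilt n k}
      mul_mem' := fun ⟨k, hk⟩ ⟨k', hk'⟩ => ⟨k + k', mul_mem_lenFilt hk hk'⟩
      add_mem' := fun ⟨k, hk⟩ ⟨k', hk'⟩ =>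
        ⟨max k k', add_mem (lenFilt_mono (le_max_left _ _) hk) (lenFilt_mono (le_max_right _ _) hk')⟩
      algebraMap_mem' := fun c => ⟨0, by
        rw [Algebra.algebraMap_eq_smul_one]
        exact Submodule.smul_mem _ _ (Submodule.subset_span ⟨[], by simp, by simp [wordElt]⟩)⟩ }
  let f : CurrentGl n →ₗ⁅ℂ⁆ A :=
    { toFun := fun x => ⟨UniversalEnvelopingAlgebra.ι ℂ x, 1, ι_mem_lenFilt x⟩
      map_add' := fun x y => Subtype.ext (map_add _ x y)
      map_smul' := fun c x => Subtype.ext (map_smul _ c x)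
      map_lie' := fun {x y} => Subtype.ext (LieHom.map_lie _ x y) }
  have h : A.val.comp (UniversalEnvelopingAlgebra.lift ℂ f) = AlgHom.id ℂ (UCurrentGl n) := by
    refine UniversalEnvelopingAlgebra.hom_ext _ (LieHom.ext fun x => ?_)
    change A.val (UniversalEnvelopingAlgebra.lift ℂ f (UniversalEnvelopingAlgebra.ι ℂ x)) = _
    rw [UniversalEnvelopingAlgebra.lift_ι_apply]
    rfl
  have := congrArg (fun g => g u) h
  simp only [AlgHom.comp_apply, AlgHom.id_apply] at this
  rw [← this]
  exact (UniversalEnvelopingAlgebra.lift ℂ f u).2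

lemma unitElt_commutator_mem (q r : Fin n × Fin n × ℕ) :
    unitElt q.1 q.2.1 q.2.2 * unitElt r.1 r.2.1 r.2.2 -
      unitElt r.1 r.2.1 r.2.2 * unitElt q.1 q.2.1 q.2.2 ∈ lenFilt n 1 := by
  have : unitElt q.1 q.2.1 q.2.2 * unitElt r.1 r.2.1 r.2.2 -
      unitElt r.1 r.2.1 r.2.2 * unitElt q.1 q.2.1 q.2.2 =
      currentHom n (q.2.2 + r.2.2) ⁅Matrix.single q.1 q.2.1 (1 : ℂ), Matrix.single r.1 r.2.1 1⁆ := by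
    rw [currentHom_apply, pow_add, ← lie_currentElt]
    rfl
  rw [this]
  exact currentHom_mem _ _

/-- Exchanging two neighbouring generators costs their commutator, which is linear in the
generators, so reordering only matters in lower length. -/
lemma wordElt_sub_mem_of_perm {l l' : List (Fin n × Fin n × ℕ)} (h : l.Perm l') :
    wordElt l - wordElt l' ∈ lenFilt n (l.length - 1) := by
  induction h with
  | nil => simp
  | @cons q l l' h ih =>
    rcases l with _ | ⟨r, l⟩
    · rw [List.nil_perm] at h; subst h; simp
    · have : wordElt (q :: r :: l) - wordElt (q :: l') =
          unitElt q.1 q.2.1 q.2.2 * (wordElt (r :: l) - wordElt l') := by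
        simp [wordElt, mul_sub]
      rw [this]
      refine lenFilt_mono ?_ (mul_mem_lenFilt (unitElt_mem _ _ _) ih)
      simp; lia
  | swap q r l =>
    have : wordElt (r :: q :: l) - wordElt (q :: r :: l) =
        (unitElt r.1 r.2.1 r.2.2 * unitElt q.1 q.2.1 q.2.2 -
          unitElt q.1 q.2.1 q.2.2 * unitElt r.1 r.2.1 r.2.2) * wordElt l := by
      simp [wordElt, sub_mul, mul_assoc]
    rw [this]
    refine lenFilt_mono ?_ (mul_mem_lenFilt (unitElt_commutator_mem r q) (wordElt_mem le_rfl))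
    simp; lia
  | trans h h' ih ih' =>
    rw [← h.length_eq] at ih'
    simpa using add_mem ih ih'

/-- The product of the elements `yₐ(mₐ)` as a multilinear map. -/
def currentProd {k : ℕ} (m : Fin k → ℕ) :
    MultilinearMap ℂ (fun _ : Fin k => Gl n) (UCurrentGl n) :=
  (MultilinearMap.mkPiAlgebraFin ℂ k (UCurrentGl n)).compLinearMap fun a => currentHom n (m a)

lemma currentProd_apply {k : ℕ} (m : Fin k → ℕ) (y : Fin k → Gl n) :
    currentProd m y = (List.ofFn fun a => currentHom n (m a) (y a)).prod := by
  simp [currentProd, MultilinearMap.mkPiAlgebraFin_apply]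

/-- The Leibniz rule for the inner derivation by `w`, written as a sum over positions. -/
lemma commutator_prod_ofFn {A : Type*} [Ring A] (w : A) {k : ℕ} (f : Fin k → A) :
    w * (List.ofFn f).prod - (List.ofFn f).prod * w =
      ∑ a, (List.ofFn (Function.update f a (w * f a - f a * w))).prod := by
  induction k with
  | zero => simp
  | succ k ih =>
    have h0 : (fun i : Fin k => Function.update f 0 (w * f 0 - f 0 * w) i.succ) =
        fun i => f i.succ := by
      ext i; simp
    have h1 (a : Fin k) : (fun i : Fin k =>
        Function.update f a.succ (w * f a.succ - f a.succ * w) i.succ) =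
        Function.update (fun i => f i.succ) a (w * f a.succ - f a.succ * w) := by
      ext i
      by_cases h : i = a
      · subst h; simp
      · simp [h]
    have h2 (a : Fin k) (z : A) : Function.update f a.succ z 0 = f 0 :=
      Function.update_of_ne (Fin.succ_ne_zero a).symm _ _
    simp only [Fin.sum_univ_succ, List.ofFn_succ, List.prod_cons, h0, h1, h2,
      Function.update_self, ← Finset.mul_sum, ← ih]
    noncomm_ring

lemma lie_currentProd (x : Gl n) {k : ℕ} (m : Fin k → ℕ) (y : Fin k → Gl n) :
    ⁅currentElt x 1, currentProd m y⁆ =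
      ∑ a, currentProd m (Function.update y a (x * y a - y a * x)) := by
  have h : ⁅currentElt x 1, currentProd m y⁆ =
    currentElt x 1 * currentProd m y - currentProd m y * currentElt x 1 := rfl
  rw [h, currentProd_apply, commutator_prod_ofFn]
  refine Finset.sum_congr rfl fun a _ => ?_
  rw [currentProd_apply]
  congr 2
  ext b
  by_cases hb : b = a
  · subst hb
    simp only [Function.update_self, currentHom_apply]
    have h' := lie_currentElt x (y b) 1 (X ^ m b)
    rw [one_mul] at h'
    exact h'
  · simp [hb]

/-- The element of the enveloping algebra with the given coefficient matrix, in the words with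
fixed powers of `t`. -/
def tensorElt {k : ℕ} (m : Fin k → ℕ) :
    Matrix (Fin k → Fin n) (Fin k → Fin n) ℂ →ₗ[ℂ] UCurrentGl n where
  toFun T := ∑ p : Fin k → Fin n × Fin n, T (fun a => (p a).1) (fun a => (p a).2) •
    currentProd m fun a => Matrix.single (p a).1 (p a).2 1
  map_add' S T := by simp [add_smul, Finset.sum_add_distrib]
  map_smul' c T := by simp [Finset.smul_sum, smul_smul]

lemma tensorElt_apply {k : ℕ} (m : Fin k → ℕ) (T : Matrix (Fin k → Fin n) (Fin k → Fin n) ℂ) :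
    tensorElt m T = ∑ p : Fin k → Fin n × Fin n, T (fun a => (p a).1) (fun a => (p a).2) •
      currentProd m fun a => Matrix.single (p a).1 (p a).2 1 := rfl

lemma tensorElt_tensorMatrix {k : ℕ} (m : Fin k → ℕ) (y : Fin k → Gl n) :
    tensorElt m (tensorMatrix y) = currentProd m y := by
  have hy (a : Fin k) : y a = ∑ q : Fin n × Fin n, y a q.1 q.2 • Matrix.single q.1 q.2 (1 : ℂ) := by
    conv_lhs => rw [Matrix.matrix_eq_sum_single (y a)]
    simp [Fintype.sum_prod_type]
  conv_rhs => rw [show y = fun a => ∑ q : Fin n × Fin n, y a q.1 q.2 •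
    Matrix.single q.1 q.2 (1 : ℂ) from funext hy]
  rw [MultilinearMap.map_sum, tensorElt_apply]
  refine Finset.sum_congr rfl fun p _ => ?_
  rw [MultilinearMap.map_smul_univ]
  rfl

/-- Both sides are linear in `T`, and matrix units are elementary tensors, on which this is the
Leibniz rule. It moves the question of invariants into the matrix algebra. -/
lemma lie_tensorElt (x : Gl n) {k : ℕ} (m : Fin k → ℕ)
    (T : Matrix (Fin k → Fin n) (Fin k → Fin n) ℂ) :
    ⁅currentElt x 1, tensorElt m T⁆ =
      tensorElt m (diagAction (Fin k) x * T - T * diagAction (Fin k) x) := by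
  have key (y : Fin k → Gl n) : ⁅currentElt x 1, tensorElt m (tensorMatrix y)⁆ =
      tensorElt m (diagAction (Fin k) x * tensorMatrix y - tensorMatrix y * diagAction (Fin k) x) := by
    rw [tensorElt_tensorMatrix, lie_currentProd, diagAction, Finset.sum_mul, Finset.mul_sum,
      ← Finset.sum_sub_distrib, map_sum]
    refine Finset.sum_congr rfl fun a _ => ?_
    rw [tensorMatrix_mul, tensorMatrix_mul, map_sub, tensorElt_tensorMatrix,
      tensorElt_tensorMatrix, MultilinearMap.map_update_sub]
    congr 2
    · ext b : 1
      by_cases hb : b = a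
      · subst hb; simp
      · simp [hb]
    · ext b : 1
      by_cases hb : b = a
      · subst hb; simp
      · simp [hb]
  rw [Matrix.matrix_eq_sum_single T]
  have hlie {ι : Type} (s : Finset ι) (f : ι → UCurrentGl n) :
      ⁅currentElt x 1, ∑ i ∈ s, f i⁆ = ∑ i ∈ s, ⁅currentElt x 1, f i⁆ := by
    simp [Ring.lie_def, Finset.mul_sum, Finset.sum_mul]
  simp only [Finset.mul_sum, Finset.sum_mul, map_sum, ← Finset.sum_sub_distrib, hlie]
  refine Finset.sum_congr rfl fun i _ => Finset.sum_congr rfl fun j _ => ?_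
  have : Matrix.single i j (T i j) = T i j • Matrix.single i j (1 : ℂ) := by simp
  rw [this, map_smul, Matrix.mul_smul, Matrix.smul_mul, ← smul_sub, map_smul,
    single_eq_tensorMatrix, ← key]
  simp [Ring.lie_def, smul_sub]

end Invariants


/-! ### Invariants attached to permutations. -/

section Invariants

variable {n : ℕ}

/-- The element `∑ᵢ E_{i₁ i_{σ 1}}(m₁) ⋯ E_{i_k i_{σ k}}(m_k)` attached to a permutation. -/
def permElt (n : ℕ) {k : ℕ} (m : Fin k → ℕ) (σ : Equiv.Perm (Fin k)) : UCurrentGl n :=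
  tensorElt m (placePerm (Fin n) σ)

/-- The element attached to a permutation, with the factors multiplied in a prescribed order. -/
def permListElt (n : ℕ) {k : ℕ} (m : Fin k → ℕ) (σ : Equiv.Perm (Fin k)) (l : List (Fin k)) :
    UCurrentGl n :=
  ∑ i : Fin k → Fin n, wordElt (l.map fun a => (i a, i (σ a), m a))

lemma permElt_eq {k : ℕ} (m : Fin k → ℕ) (σ : Equiv.Perm (Fin k)) :
    permElt n m σ = permListElt n m σ (List.finRange k) := by
  rw [permElt, tensorElt_apply, permListElt]
  refine (Fintype.sum_equiv
    (Equiv.arrowProdEquivProdArrow (Fin k) (fun _ => Fin n) fun _ => Fin n) _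
    (fun q : (Fin k → Fin n) × (Fin k → Fin n) => placePerm (Fin n) σ q.1 q.2 •
      currentProd m fun a => Matrix.single (q.1 a) (q.2 a) 1) fun p => rfl).trans ?_
  rw [Fintype.sum_prod_type]
  refine Finset.sum_congr rfl fun i _ => ?_
  rw [Finset.sum_eq_single (i ∘ σ)]
  · simp only [placePerm, if_true, one_smul, currentProd_apply, wordElt, List.map_map]
    rw [← List.ofFn_eq_map]
    rfl
  · intro j _ hj
    simp [placePerm, hj]
  · simp

lemma cycleElt_eq {k : ℕ} (m : Fin k → ℕ) : cycleElt n m = permElt n m (finRotate k) := by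
  rw [permElt_eq, permListElt, cycleElt]
  refine Finset.sum_congr rfl fun i _ => ?_
  rw [wordElt, List.map_map, List.ofFn_eq_map]
  rfl

lemma mem_glInvariants {u : UCurrentGl n} :
    u ∈ glInvariants n ↔ ∀ x : Gl n, ⁅currentElt x 1, u⁆ = 0 := Iff.rfl

lemma permElt_mem_glInvariants {k : ℕ} (m : Fin k → ℕ) (σ : Equiv.Perm (Fin k)) :
    permElt n m σ ∈ glInvariants n := by
  rw [mem_glInvariants]
  intro x
  rw [permElt, lie_tensorElt, (commute_diagAction_placePerm σ x).eq, sub_self, map_zero]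

lemma permListElt_mem_lenFilt {k : ℕ} (m : Fin k → ℕ) (σ : Equiv.Perm (Fin k))
    (l : List (Fin k)) : permListElt n m σ l ∈ lenFilt n l.length :=
  sum_mem fun _ _ => wordElt_mem (by simp)

lemma permElt_mem_lenFilt {k : ℕ} (m : Fin k → ℕ) (σ : Equiv.Perm (Fin k)) :
    permElt n m σ ∈ lenFilt n k := by
  rw [permElt_eq]
  exact lenFilt_mono (by simp) (permListElt_mem_lenFilt m σ _)

/-! ### Several word shapes at once. -/

section Blocks

variable {K : Type} [Fintype K] [DecidableEq K] (d : K → Σ k : ℕ, (Fin k → ℕ))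

/-- The sum of the maps `tensorElt` over a finite family of word shapes, on the diagonal blocks of
a matrix. -/
def blockElt : Matrix (Σ s : K, (Fin (d s).1 → Fin n)) (Σ s : K, (Fin (d s).1 → Fin n)) ℂ →ₗ[ℂ]
    UCurrentGl n where
  toFun T := ∑ s : K, tensorElt (d s).2 (T.blockDiag' s)
  map_add' S T := by simp [ Finset.sum_add_distrib]
  map_smul' c T := by simp [ Finset.smul_sum]

/-- The diagonal action on a finite direct sum of tensor powers. -/
def blockAction (x : Gl n) :
    Matrix (Σ s : K, (Fin (d s).1 → Fin n)) (Σ s : K, (Fin (d s).1 → Fin n)) ℂ :=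
  Matrix.blockDiagonal' fun s => diagAction (Fin (d s).1) x

lemma blockDiag'_blockAction_mul (x : Gl n)
    (T : Matrix (Σ s : K, (Fin (d s).1 → Fin n)) (Σ s : K, (Fin (d s).1 → Fin n)) ℂ) (s : K) :
    (blockAction d x * T).blockDiag' s =
      diagAction (Fin (d s).1) x * T.blockDiag' s := by
  ext i j
  simp only [Matrix.blockDiag'_apply, Matrix.mul_apply, blockAction, Fintype.sum_sigma]
  rw [Finset.sum_eq_single s]
  · simp only [Matrix.blockDiagonal'_apply_eq]
  · intro s' _ hs'
    simp only [Matrix.blockDiagonal'_apply_ne _ _ _ (Ne.symm hs'), zero_mul, Finset.sum_const_zero]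
  · simp

lemma blockDiag'_mul_blockAction (x : Gl n)
    (T : Matrix (Σ s : K, (Fin (d s).1 → Fin n)) (Σ s : K, (Fin (d s).1 → Fin n)) ℂ) (s : K) :
    (T * blockAction d x).blockDiag' s =
      T.blockDiag' s * diagAction (Fin (d s).1) x := by
  ext i j
  simp only [Matrix.blockDiag'_apply, Matrix.mul_apply, blockAction, Fintype.sum_sigma]
  rw [Finset.sum_eq_single s]
  · simp only [Matrix.blockDiagonal'_apply_eq]
  · intro s' _ hs'
    simp only [Matrix.blockDiagonal'_apply_ne _ _ _ hs', mul_zero, Finset.sum_const_zero]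
  · simp

lemma lie_blockElt (x : Gl n)
    (T : Matrix (Σ s : K, (Fin (d s).1 → Fin n)) (Σ s : K, (Fin (d s).1 → Fin n)) ℂ) :
    ⁅currentElt x 1, blockElt d T⁆ = blockElt d (blockAction d x * T - T * blockAction d x) := by
  have h1 : ⁅currentElt x 1, blockElt d T⁆ = ∑ s : K,
      ⁅currentElt x 1, tensorElt (d s).2 (T.blockDiag' s)⁆ := by
    simp [Ring.lie_def, blockElt, Finset.mul_sum, Finset.sum_mul]
  rw [h1]
  refine Finset.sum_congr rfl fun s _ => ?_
  rw [lie_tensorElt, Matrix.blockDiag'_sub, Pi.sub_apply, blockDiag'_blockAction_mul,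
    blockDiag'_mul_blockAction]

/-- Invariants among the combinations of finitely many word shapes are combinations of the
elements attached to permutations. -/
lemma blockElt_mem_span_permElt
    (T : Matrix (Σ s : K, (Fin (d s).1 → Fin n)) (Σ s : K, (Fin (d s).1 → Fin n)) ℂ)
    (hT : blockElt d T ∈ glInvariants n) :
    blockElt d T ∈ Submodule.span ℂ {u | ∃ s σ, u = permElt n (d s).2 σ} := by
  rw [mem_glInvariants] at hT
  -- Words of different shapes may be linearly dependent in the enveloping algebra, so the invariant
  -- is lifted over all shapes simultaneously. Only then is the first fundamental theorem applied,
  -- block by block.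
  obtain ⟨T', hT', hcomm⟩ := exists_commute_lift (blockElt d) (Set.range (blockAction d))
    (by
      rintro _ ⟨x, rfl⟩
      refine ⟨x.conjTranspose, ?_⟩
      rw [blockAction, blockAction, Matrix.blockDiagonal'_conjTranspose]
      congr 1
      ext s : 1
      exact (diagAction_conjTranspose x).symm)
    (by
      rintro _ ⟨x, rfl⟩ S hS
      rw [← lie_blockElt, hS, Ring.lie_def, mul_zero, zero_mul, sub_zero])
    (T := T) (by
      rintro _ ⟨x, rfl⟩
      rw [← lie_blockElt, hT])
  rw [← hT']
  refine sum_mem fun s _ => ?_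
  have hs : T'.blockDiag' s ∈
      Submodule.span ℂ (Set.range (placePerm (κ := Fin (d s).1) (Fin n))) := by
    refine mem_span_placePerm fun x => ?_
    have := congrArg (fun S => Matrix.blockDiag' S s) (hcomm _ ⟨x, rfl⟩).eq
    simp only [blockDiag'_blockAction_mul, blockDiag'_mul_blockAction] at this
    exact this
  have := Submodule.mem_map_of_mem (f := tensorElt (n := n) (d s).2) hs
  rw [Submodule.map_span] at this
  refine Submodule.span_mono ?_ this
  rintro _ ⟨_, ⟨σ, rfl⟩, rfl⟩
  exact ⟨s, σ, rfl⟩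

end Blocks

/-- Invariants of filtration degree `k` are combinations of the elements attached to permutations
of at most `k` letters. -/
lemma mem_span_permElt_of_mem_lenFilt {k : ℕ} {u : UCurrentGl n} (hu : u ∈ lenFilt n k)
    (hinv : u ∈ glInvariants n) :
    u ∈ Submodule.span ℂ {u | ∃ (k' : ℕ) (m : Fin k' → ℕ) (σ : Equiv.Perm (Fin k')),
      k' ≤ k ∧ u = permElt n m σ} := by
  let ι := {s : Σ k' : ℕ, (Fin k' → ℕ) // s.1 ≤ k}
  have hle : lenFilt n k ≤ ⨆ s : ι, LinearMap.range (tensorElt (n := n) s.1.2) := by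
    refine Submodule.span_le.mpr ?_
    rintro _ ⟨l, hl, rfl⟩
    refine Submodule.mem_iSup_of_mem (⟨⟨l.length, fun a => (l.get a).2.2⟩, hl⟩ : ι) ?_
    refine ⟨tensorMatrix fun a => Matrix.single (l.get a).1 (l.get a).2.1 1, ?_⟩
    rw [tensorElt_tensorMatrix, currentProd_apply, wordElt]
    conv_rhs => rw [← List.ofFn_get l, List.map_ofFn]
    rfl
  obtain ⟨f, hf, rfl⟩ := (Submodule.mem_iSup_iff_exists_finsupp _ _).mp (hle hu)
  choose T hT using hf
  let d : f.support → Σ k' : ℕ, (Fin k' → ℕ) := fun s => s.1.1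
  classical
  have hsum : (f.sum fun _ x => x) = blockElt d (Matrix.blockDiagonal' fun s => T s.1) := by
    rw [Finsupp.sum, ← Finset.sum_coe_sort]
    refine Finset.sum_congr rfl fun s _ => ?_
    rw [← hT s.1]
    congr 1
    ext i j
    simp
  rw [hsum] at hinv ⊢
  refine Submodule.span_mono ?_ (blockElt_mem_span_permElt d _ hinv)
  rintro _ ⟨s, σ, rfl⟩
  exact ⟨_, _, σ, s.1.2, rfl⟩

end Invariants


/-! ### Splitting off cycles and the proof of generation. -/

section Invariants

variable {n : ℕ}

lemma val_finRotate {r : ℕ} (a : Fin r) : (finRotate r a : ℕ) = (a + 1) % r := by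
  obtain _ | r := r
  · exact a.elim0
  · rw [finRotate_apply, Fin.val_add]
    simp [Nat.add_mod]

/-- A permutation of a nonempty finite set splits off the cycle through a point. -/
lemma exists_cycle_splitting {α : Type*} [Fintype α] (σ : Equiv.Perm α) (x : α) :
    ∃ (r q : ℕ) (E : Fin r ⊕ Fin q ≃ α) (τ : Equiv.Perm (Fin q)), 1 ≤ r ∧
      (∀ a, σ (E (.inl a)) = E (.inl (finRotate r a))) ∧
      ∀ a, σ (E (.inr a)) = E (.inr (τ a)) := by
  classical
  set r := Function.minimalPeriod σ x with hr
  have hpos : 0 < r := Function.minimalPeriod_pos_of_mem_periodicPts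
    (Function.mem_periodicPts.mpr ⟨orderOf σ, orderOf_pos σ, by
      rw [Function.IsPeriodicPt, Function.IsFixedPt, ← Equiv.Perm.coe_pow, pow_orderOf_eq_one]
      rfl⟩)
  have hcyc (a : ℕ) : σ.SameCycle x (σ^[a] x) := ⟨a, by rw [zpow_natCast, Equiv.Perm.coe_pow]⟩
  -- Numbering the cycle by the iterates of `x` turns `σ` into `finRotate`, the shape required by
  -- `cycleElt`.
  let e₁ : Fin r ≃ {y // σ.SameCycle x y} := Equiv.ofBijective (fun a => ⟨σ^[a] x, hcyc a⟩) (by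
    constructor
    · intro a b hab
      exact Fin.ext ((Function.iterate_injOn_Iio_minimalPeriod (f := σ) (x := x)) a.2 b.2
        (Subtype.ext_iff.mp hab))
    · rintro ⟨y, hy⟩
      obtain ⟨i, -, hi⟩ := hy.exists_pow_eq'
      refine ⟨⟨i % r, Nat.mod_lt _ hpos⟩, Subtype.ext ?_⟩
      change σ^[i % r] x = y
      rw [hr, Function.iterate_mod_minimalPeriod_eq, ← Equiv.Perm.coe_pow, hi])
  let e₂ := Fintype.equivFin {y // ¬ σ.SameCycle x y}
  have hiff (y : α) : ¬ σ.SameCycle x y ↔ ¬ σ.SameCycle x (σ y) := by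
    rw [Equiv.Perm.sameCycle_apply_right]
  let τ' : Equiv.Perm {y // ¬ σ.SameCycle x y} := σ.subtypePerm fun y => (hiff y).symm
  refine ⟨r, _, (Equiv.sumCongr e₁ e₂.symm).trans (Equiv.sumCompl _),
    e₂.permCongr τ', hpos, fun a => ?_, fun a => ?_⟩
  · change σ (σ^[a] x) = σ^[(finRotate r a : Fin r)] x
    rw [← Function.iterate_succ_apply' (f := σ), ← Function.iterate_mod_minimalPeriod_eq (f := σ)
      (n := (a : ℕ).succ), ← hr]
    congr 1
    exact (val_finRotate a).symm
  · simp [τ']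

/-- When the letters of two `σ`-stable blocks are listed one block after the other, no index is
shared between the two halves of the word and the sum factors. -/
lemma permListElt_append {k r q : ℕ} (m : Fin k → ℕ) (σ : Equiv.Perm (Fin k))
    (E : Fin r ⊕ Fin q ≃ Fin k) (ρ : Equiv.Perm (Fin r)) (τ : Equiv.Perm (Fin q))
    (h₁ : ∀ a, σ (E (.inl a)) = E (.inl (ρ a))) (h₂ : ∀ a, σ (E (.inr a)) = E (.inr (τ a))) :
    permListElt n m σ (((List.finRange r).map fun a => E (.inl a)) ++
        (List.finRange q).map fun a => E (.inr a)) =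
      permElt n (fun a => m (E (.inl a))) ρ * permElt n (fun a => m (E (.inr a))) τ := by
  rw [permElt_eq, permElt_eq, permListElt, permListElt, permListElt, Finset.sum_mul_sum,
    ← Fintype.sum_prod_type']
  refine Fintype.sum_equiv ((Equiv.arrowCongr E.symm (Equiv.refl (Fin n))).trans
    (Equiv.sumArrowEquivProdArrow _ _ _)) _ _ fun i => ?_
  simp only [wordElt, List.map_append, List.prod_append, List.map_map]
  congr 2 <;> refine List.map_congr_left fun a _ => ?_
  · simp [h₁, Equiv.sumArrowEquivProdArrow]
  · simp [h₂, Equiv.sumArrowEquivProdArrow]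

/-- The algebra generated by the cycle elements. -/
def cycleAlgebra (n : ℕ) : Subalgebra ℂ (UCurrentGl n) :=
  Algebra.adjoin ℂ {u : UCurrentGl n | ∃ (k : ℕ) (m : Fin k → ℕ), 1 ≤ k ∧ u = cycleElt n m}

/-- Reordering the factors so that one cycle comes first gives a cycle element times the element of
a permutation on `q < k` letters. The error made is an invariant of length at most `k - 1`, so both
pieces fall under the induction hypothesis. -/
lemma permElt_mem_cycleAlgebra {k : ℕ} (hk : ∀ k' < k, ∀ u ∈ lenFilt n k', u ∈ glInvariants n →
      u ∈ cycleAlgebra n) (m : Fin k → ℕ) (σ : Equiv.Perm (Fin k)) :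
    permElt n m σ ∈ cycleAlgebra n := by
  rcases Nat.eq_zero_or_pos k with rfl | hpos
  · have : permElt n m σ = 1 := by simp [permElt_eq, permListElt, wordElt]
    rw [this]
    exact one_mem _
  obtain ⟨r, q, E, τ, hr, h₁, h₂⟩ := exists_cycle_splitting σ ⟨0, hpos⟩
  have hcard : r + q = k := by simpa using Fintype.card_congr E
  set l := ((List.finRange r).map fun a => E (.inl a)) ++ (List.finRange q).map fun a => E (.inr a)
    with hl
  have hlk : (List.finRange k).Perm l := by
    refine (List.perm_ext_iff_of_nodup (List.nodup_finRange k) ?_).mpr fun b => ?_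
    · rw [hl, List.nodup_append]
      refine ⟨(List.nodup_finRange r).map fun a b h => by simpa using h,
        (List.nodup_finRange q).map fun a b h => by simpa using h, ?_⟩
      simp
    · obtain ⟨c, rfl⟩ := E.surjective b
      rcases c with c | c <;> simp [hl]
  have hprod : permListElt n m σ l ∈ cycleAlgebra n := by
    rw [hl, permListElt_append m σ E (finRotate r) τ h₁ h₂]
    refine mul_mem (Algebra.subset_adjoin ⟨r, _, hr, (cycleElt_eq _).symm⟩) ?_
    exact hk q (by lia) _ (permElt_mem_lenFilt _ _) (permElt_mem_glInvariants _ _)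
  have hinv : permListElt n m σ l ∈ glInvariants n := by
    rw [hl, permListElt_append m σ E (finRotate r) τ h₁ h₂]
    exact mul_mem (permElt_mem_glInvariants _ _) (permElt_mem_glInvariants _ _)
  have hdiff : permElt n m σ - permListElt n m σ l ∈ lenFilt n (k - 1) := by
    rw [permElt_eq, permListElt, permListElt, ← Finset.sum_sub_distrib]
    refine sum_mem fun i _ => ?_
    have := wordElt_sub_mem_of_perm (hlk.map fun a => (i a, i (σ a), m a))
    simpa using this
  have := hk (k - 1) (by lia) _ hdiff (sub_mem (permElt_mem_glInvariants _ _) hinv)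
  simpa using add_mem this hprod

/-- The cycle elements generate the invariants. -/
theorem cycleAlgebra_eq_glInvariants (n : ℕ) : cycleAlgebra n = glInvariants n := by
  apply le_antisymm
  · refine Algebra.adjoin_le ?_
    rintro _ ⟨k, m, -, rfl⟩
    rw [cycleElt_eq]
    exact permElt_mem_glInvariants _ _
  · have key (k : ℕ) : ∀ u ∈ lenFilt n k, u ∈ glInvariants n → u ∈ cycleAlgebra n := by
      induction k using Nat.strong_induction_on with
      | _ k ih =>
        intro u hu hinv
        refine (Submodule.span_le (p := Subalgebra.toSubmodule (cycleAlgebra n))).mpr ?_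
          (mem_span_permElt_of_mem_lenFilt hu hinv)
        rintro _ ⟨k', m, σ, hk', rfl⟩
        exact permElt_mem_cycleAlgebra (fun k'' hk'' => ih k'' (hk''.trans_le hk')) m σ
    intro u hu
    obtain ⟨k, hk⟩ := exists_mem_lenFilt u
    exact key k u hk hu

end Invariants


/-! ### Adjoint tensors over a ring containing a copy of `gl` -/

section AdjointTensor

set_option linter.unusedSectionVars false

open Matrix Finset

variable {A ν : Type*} [Ring A] [Fintype ν] [DecidableEq ν]

/-- `Y` transforms under commutators with the entries of `E` like the matrix of generators of
`gl`. -/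
def IsAdjointTensor (E Y : Matrix ν ν A) : Prop :=
  ∀ i j k l, E i j * Y k l - Y k l * E i j =
    (if j = k then Y i l else 0) - (if i = l then Y k j else 0)

variable {E Y Z B : Matrix ν ν A}

lemma IsAdjointTensor.one : IsAdjointTensor E 1 := by
  intro i j k l
  by_cases h1 : j = k <;> by_cases h2 : i = l <;> by_cases h3 : k = l <;>
    by_cases h4 : i = l <;> by_cases h5 : k = j <;> simp_all [Matrix.one_apply]

lemma IsAdjointTensor.mul (hY : IsAdjointTensor E Y) (hZ : IsAdjointTensor E Z) :
    IsAdjointTensor E (Y * Z) := by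
  intro i j k l
  have h (m : ν) : E i j * (Y k m * Z m l) - Y k m * Z m l * E i j =
      ((if j = k then Y i m else 0) - (if i = m then Y k j else 0)) * Z m l +
        Y k m * ((if j = m then Z i l else 0) - (if i = l then Z m j else 0)) := by
    rw [← hY, ← hZ]
    noncomm_ring
  simp only [Matrix.mul_apply, Finset.mul_sum, Finset.sum_mul, ← Finset.sum_sub_distrib, h]
  simp only [sub_mul, mul_sub, Finset.sum_add_distrib, Finset.sum_sub_distrib]
  split_ifs <;> simp
  abel

lemma IsAdjointTensor.pow (hY : IsAdjointTensor E Y) (a : ℕ) : IsAdjointTensor E (Y ^ a) := by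
  induction a with
  | zero => rw [pow_zero]; exact .one
  | succ a ih => rw [pow_succ]; exact ih.mul hY

lemma IsAdjointTensor.commute_trace (hY : IsAdjointTensor E Y) (i j : ν) :
    Commute (E i j) Y.trace := by
  rw [Commute, SemiconjBy, ← sub_eq_zero, Matrix.trace, Finset.mul_sum, Finset.sum_mul,
    ← Finset.sum_sub_distrib]
  simp only [Matrix.diag_apply]
  rw [Finset.sum_congr rfl fun k _ => hY i j k k]
  simp [Finset.sum_sub_distrib]

lemma commute_pow_apply {w : A} (hw : ∀ i j, Commute (E i j) w) (a : ℕ) (i j : ν) :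
    Commute ((E ^ a) i j) w := by
  induction a generalizing i j with
  | zero => rw [pow_zero, Matrix.one_apply]; split_ifs <;> simp
  | succ a ih =>
    rw [pow_succ, Matrix.mul_apply]
    exact Commute.sum_left _ _ _ fun k _ => (ih i k).mul_left (hw k j)

lemma commute_trace_pow {w : A} (hw : ∀ i j, Commute (E i j) w) (a : ℕ) :
    Commute (E ^ a).trace w :=
  Commute.sum_left _ _ _ fun k _ => commute_pow_apply hw a k k

/-- Commuting `Y` past the `a` factors of `Eᵃ` one at a time: `p` counts the factors of `E` to the
left of the one being crossed. -/
lemma IsAdjointTensor.pow_commutator (hY : IsAdjointTensor E Y) (a : ℕ) (i j k l : ν) :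
    (E ^ a) i j * Y k l - Y k l * (E ^ a) i j =
      ∑ p ∈ range a, ((E ^ p * Y) i l * (E ^ (a - 1 - p)) k j -
        (E ^ p) i l * (Y * E ^ (a - 1 - p)) k j) := by
  induction a generalizing i with
  | zero => simp [Matrix.one_apply]
  | succ a ih =>
    have h1 : (E ^ (a + 1)) i j * Y k l - Y k l * (E ^ (a + 1)) i j =
        ∑ m, E i m * ((E ^ a) m j * Y k l - Y k l * (E ^ a) m j) +
          ∑ m, (E i m * Y k l - Y k l * E i m) * (E ^ a) m j := by
      rw [pow_succ', Matrix.mul_apply, Finset.mul_sum, Finset.sum_mul, ← Finset.sum_sub_distrib,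
        ← Finset.sum_add_distrib]
      exact Finset.sum_congr rfl fun m _ => by noncomm_ring
    have h2 : ∑ m, (E i m * Y k l - Y k l * E i m) * (E ^ a) m j =
        Y i l * (E ^ a) k j - (1 : Matrix ν ν A) i l * (Y * E ^ a) k j := by
      rw [Finset.sum_congr rfl fun m _ => by rw [hY i m k l]]
      simp only [sub_mul, Finset.sum_sub_distrib, ite_mul, zero_mul, Matrix.mul_apply (M := Y),
        Matrix.one_apply]
      split_ifs <;> simp
    rw [h1, h2, Finset.sum_range_succ']
    simp only [ih, Nat.add_sub_cancel, Nat.sub_zero, pow_zero, one_mul]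
    congr 1
    simp only [Finset.mul_sum]
    rw [Finset.sum_comm]
    refine Finset.sum_congr rfl fun p _ => ?_
    rw [show a - (p + 1) = a - 1 - p by lia, pow_succ', Matrix.mul_assoc,
      Matrix.mul_apply (M := E) (N := E ^ p * Y), Matrix.mul_apply (M := E) (N := E ^ p),
      Finset.sum_mul, Finset.sum_mul, ← Finset.sum_sub_distrib]
    exact Finset.sum_congr rfl fun m _ => by rw [mul_sub, mul_assoc, mul_assoc]

/-- The trace of a product of a power of `E` with an adjoint tensor does not depend on the order
of the factors. -/
lemma IsAdjointTensor.trace_pow_mul (hE : IsAdjointTensor E E) (hY : IsAdjointTensor E Y)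
    (a : ℕ) : (E ^ a * Y).trace = (Y * E ^ a).trace := by
  induction a using Nat.strong_induction_on with
  | _ a ih =>
    rw [← sub_eq_zero]
    have h1 : (E ^ a * Y).trace - (Y * E ^ a).trace =
        ∑ i, ∑ j, ((E ^ a) i j * Y j i - Y j i * (E ^ a) i j) := by
      simp only [Matrix.trace, Matrix.diag_apply, Matrix.mul_apply, Finset.sum_sub_distrib]
      congr 1
      exact Finset.sum_comm
    have h2 : ∑ i, ∑ j, ((E ^ a) i j * Y j i - Y j i * (E ^ a) i j) =
        ∑ p ∈ range a, ((E ^ p * Y).trace * (E ^ (a - 1 - p)).trace -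
          (E ^ p).trace * (Y * E ^ (a - 1 - p)).trace) := by
      simp only [hY.pow_commutator]
      rw [Finset.sum_congr rfl fun i _ => Finset.sum_comm, Finset.sum_comm]
      refine Finset.sum_congr rfl fun p _ => ?_
      simp only [Finset.sum_sub_distrib, Matrix.trace, Matrix.diag_apply, Finset.sum_mul_sum]
    -- After the reflection `p ↦ a - 1 - p` the two sums agree termwise: the induction hypothesis
    -- applies to the smaller powers, and traces of powers of `E` commute with traces of adjoint
    -- tensors.
    rw [h1, h2, Finset.sum_sub_distrib, sub_eq_zero, ← Finset.sum_range_reflect]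
    refine Finset.sum_congr rfl fun p hp => ?_
    have hp := Finset.mem_range.mp hp
    rw [show a - 1 - (a - 1 - p) = p by lia, ih _ (by lia)]
    rw [← ih _ (by lia)]
    exact (commute_trace_pow (((hE.pow _).mul hY).commute_trace) p).eq.symm

/-- The contraction on the left has its factors in the wrong order for a matrix product; reversing
them produces the correction terms. -/
lemma IsAdjointTensor.sum_pow_mul (hY : IsAdjointTensor E Y) (a : ℕ) (j k : ν) :
    ∑ i, (E ^ a) i j * Y k i = (Y * E ^ a) k j +
      ∑ r ∈ range a, ((E ^ r * Y).trace * (E ^ (a - 1 - r)) k j -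
        (E ^ r).trace * (Y * E ^ (a - 1 - r)) k j) := by
  rw [← sub_eq_iff_eq_add', Matrix.mul_apply, ← Finset.sum_sub_distrib]
  simp only [hY.pow_commutator]
  rw [Finset.sum_comm]
  refine Finset.sum_congr rfl fun p _ => ?_
  simp only [Finset.sum_sub_distrib, Matrix.trace, Matrix.diag_apply, Finset.sum_mul]

/-- The combination of traces that computes the commutator of `tr (Eᵃ B)` and `tr (Eᵇ B)`. -/
def traceCommutator (z u : ℕ → A) (Φ : ℕ → ℕ → A) (a b : ℕ) : A :=
  ∑ p ∈ range b, ((Φ (p + a) (b - 1 - p) +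
      ∑ r ∈ range a, (z (r + p) * Φ (a - 1 - r) (b - 1 - p) -
        z r * Φ (p + (a - 1 - r)) (b - 1 - p))) -
    (Φ p (a + (b - 1 - p)) + ∑ r ∈ range a, (u (r + p) * u (a - 1 - r + (b - 1 - p)) -
      z r * Φ p (a - 1 - r + (b - 1 - p)))))

/-- Entries of `Eᵃ` commute with the invariant `tr (Eᵇ B)`, so the commutator falls on the entry of
`B` only. Entries of `B` commute with one another, so only the factors of `E` inside `Eᵇ`
contribute. The resulting contractions are then rewritten as traces. -/
lemma IsAdjointTensor.commutator_trace (hE : IsAdjointTensor E E) (hB : IsAdjointTensor E B)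
    (hBB : ∀ i j k l, Commute (B i j) (B k l)) (a b : ℕ) :
    (E ^ a * B).trace * (E ^ b * B).trace - (E ^ b * B).trace * (E ^ a * B).trace =
      traceCommutator (fun r => (E ^ r).trace) (fun r => (E ^ r * B).trace)
        (fun p q => (E ^ p * B * (E ^ q * B)).trace) a b := by
  have h1 : (E ^ a * B).trace * (E ^ b * B).trace - (E ^ b * B).trace * (E ^ a * B).trace =
      ∑ i, ∑ j, (E ^ a) i j * (B j i * (E ^ b * B).trace - (E ^ b * B).trace * B j i) := by
    rw [Matrix.trace, Finset.mul_sum, Finset.sum_mul, ← Finset.sum_sub_distrib]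
    refine Finset.sum_congr rfl fun i _ => ?_
    rw [Matrix.diag_apply, Matrix.mul_apply, Finset.mul_sum, Finset.sum_mul,
      ← Finset.sum_sub_distrib]
    refine Finset.sum_congr rfl fun j _ => ?_
    have := (commute_pow_apply (((hE.pow b).mul hB).commute_trace) a i j).eq
    rw [← mul_assoc ((E ^ b * B).trace), ← this]
    noncomm_ring
  have h2 (i j : ν) : B j i * (E ^ b * B).trace - (E ^ b * B).trace * B j i =
      ∑ p ∈ range b, ∑ k, ((E ^ p) k i * (B * (E ^ (b - 1 - p) * B)) j k -
        (E ^ p * B) k i * (E ^ (b - 1 - p) * B) j k) := by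
    have h3 (k : ν) : B j i * (E ^ b * B) k k - (E ^ b * B) k k * B j i =
        -∑ l, ((E ^ b) k l * B j i - B j i * (E ^ b) k l) * B l k := by
      rw [Matrix.mul_apply, Finset.mul_sum, Finset.sum_mul, ← Finset.sum_sub_distrib,
        ← Finset.sum_neg_distrib]
      refine Finset.sum_congr rfl fun l _ => ?_
      rw [mul_assoc ((E ^ b) k l), (hBB l k j i).eq]
      noncomm_ring
    rw [Matrix.trace, Finset.mul_sum, Finset.sum_mul, ← Finset.sum_sub_distrib]
    simp only [Matrix.diag_apply, h3, hB.pow_commutator]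
    rw [Finset.sum_comm]
    refine Finset.sum_congr rfl fun k _ => ?_
    simp only [Finset.sum_mul]
    rw [Finset.sum_comm, ← Finset.sum_neg_distrib]
    refine Finset.sum_congr rfl fun p _ => ?_
    rw [← Matrix.mul_assoc B, Matrix.mul_apply (M := B * _), Matrix.mul_apply (M := E ^ (b - 1 - p)),
      Finset.mul_sum, Finset.mul_sum, ← Finset.sum_sub_distrib, ← Finset.sum_neg_distrib]
    exact Finset.sum_congr rfl fun l _ => by noncomm_ring
  have h4 (Y Z : Matrix ν ν A) (hY : IsAdjointTensor E Y) :
      ∑ i, ∑ j, ∑ k, (E ^ a) i j * (Y k i * Z j k) = (Y * E ^ a * Z).trace +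
        ∑ r ∈ range a, ((E ^ r * Y).trace * (E ^ (a - 1 - r) * Z).trace -
          (E ^ r).trace * (Y * E ^ (a - 1 - r) * Z).trace) := by
    calc ∑ i, ∑ j, ∑ k, (E ^ a) i j * (Y k i * Z j k)
        = ∑ k, ∑ j, (∑ i, (E ^ a) i j * Y k i) * Z j k := by
          rw [Finset.sum_comm, Finset.sum_congr rfl fun j _ => Finset.sum_comm, Finset.sum_comm]
          simp only [Finset.sum_mul, mul_assoc]
      _ = _ := by
          simp only [hY.sum_pow_mul, add_mul, Finset.sum_add_distrib, Finset.sum_mul, sub_mul]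
          congr 1
          rw [Finset.sum_congr rfl fun k _ => Finset.sum_comm, Finset.sum_comm]
          refine Finset.sum_congr rfl fun r _ => ?_
          simp only [Finset.sum_sub_distrib, Matrix.trace, Matrix.diag_apply, mul_assoc,
            ← Finset.mul_sum, ← Matrix.mul_apply]
  rw [h1, traceCommutator]
  simp only [h2, Finset.mul_sum, mul_sub]
  rw [Finset.sum_congr rfl fun i _ => Finset.sum_comm, Finset.sum_comm]
  refine Finset.sum_congr rfl fun p _ => ?_
  simp only [Finset.sum_sub_distrib]
  rw [h4 _ _ (hE.pow p), h4 _ _ ((hE.pow p).mul hB)]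
  simp only [← Matrix.mul_assoc, ← pow_add, Finset.sum_sub_distrib]
  simp only [Matrix.mul_assoc, ← pow_add]

/-- The point is the shape of the right-hand side: it changes sign when `a` and `b` are exchanged,
for arbitrary sequences `z`, `u`, `Φ`. -/
lemma traceCommutator_succ_sub (z u : ℕ → A) (Φ : ℕ → ℕ → A) (a b : ℕ) :
    traceCommutator z u Φ (a + 1) b - traceCommutator z u Φ a (b + 1) =
      (Φ b a - Φ a b) +
      (∑ p ∈ range b, z p * Φ a (b - 1 - p) - ∑ r ∈ range a, z r * Φ b (a - 1 - r)) -
      (∑ p ∈ range b, u (a + p) * u (b - 1 - p) - ∑ r ∈ range a, u (b + r) * u (a - 1 - r)) := by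
  let P (a b : ℕ) : A := ∑ p ∈ range b, (Φ (p + a) (b - 1 - p) - Φ p (a + (b - 1 - p)))
  let Z (a b : ℕ) : A := ∑ p ∈ range b, ∑ r ∈ range a, z (r + p) * Φ (a - 1 - r) (b - 1 - p)
  let U (a b : ℕ) : A := ∑ p ∈ range b, ∑ r ∈ range a, u (r + p) * u (a - 1 - r + (b - 1 - p))
  -- The sum is split into parts linear in `Φ`, of type `z * Φ` and of type `u * u`. In each, moving
  -- one unit from `a` to `b` telescopes up to boundary terms.
  have hX (a b : ℕ) : traceCommutator z u Φ a b =
      P a b + Z a b - U a b - ∑ r ∈ range a, z r * P (a - 1 - r) b := by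
    simp only [P, Z, U, Finset.mul_sum, traceCommutator]
    rw [Finset.sum_comm (s := range a), ← Finset.sum_add_distrib, ← Finset.sum_sub_distrib,
      ← Finset.sum_sub_distrib]
    refine Finset.sum_congr rfl fun p _ => ?_
    simp only [mul_sub, Finset.sum_sub_distrib]
    abel
  have hP (a b : ℕ) : P (a + 1) b - P a (b + 1) = Φ b a - Φ a b := by
    simp only [P, Finset.sum_sub_distrib]
    rw [Finset.sum_range_succ' (n := b), Finset.sum_range_succ (n := b)]
    have h1 : ∑ p ∈ range b, Φ (p + 1 + a) (b + 1 - 1 - (p + 1)) =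
        ∑ p ∈ range b, Φ (p + (a + 1)) (b - 1 - p) :=
      Finset.sum_congr rfl fun p _ => by congr 1 <;> lia
    have h2 : ∑ p ∈ range b, Φ p (a + (b + 1 - 1 - p)) =
        ∑ p ∈ range b, Φ p (a + 1 + (b - 1 - p)) :=
      Finset.sum_congr rfl fun p hp => by
        have := Finset.mem_range.mp hp
        congr 1; lia
    rw [h1, h2]
    simp
    abel
  have hP0 (b : ℕ) : P 0 b = 0 := by simp [P]
  have hZ : Z (a + 1) b - Z a (b + 1) =
      ∑ p ∈ range b, z p * Φ a (b - 1 - p) - ∑ r ∈ range a, z r * Φ (a - 1 - r) b := by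
    simp only [Z]
    rw [Finset.sum_range_succ' (n := b)]
    simp only [Finset.sum_range_succ' (n := a), Finset.sum_add_distrib]
    have h1 : ∑ p ∈ range b, ∑ r ∈ range a,
        z (r + 1 + p) * Φ (a + 1 - 1 - (r + 1)) (b - 1 - p) =
        ∑ p ∈ range b, ∑ r ∈ range a, z (r + (p + 1)) * Φ (a - 1 - r) (b + 1 - 1 - (p + 1)) :=
      Finset.sum_congr rfl fun p _ => Finset.sum_congr rfl fun r _ => by
        congr 2 <;> lia
    rw [h1]
    simp
  have hU : U (a + 1) b - U a (b + 1) =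
      ∑ p ∈ range b, u (a + p) * u (b - 1 - p) - ∑ r ∈ range a, u (b + r) * u (a - 1 - r) := by
    simp only [U]
    rw [Finset.sum_range_succ (n := b)]
    simp only [Finset.sum_range_succ (n := a), Finset.sum_add_distrib]
    have h1 : ∑ p ∈ range b, ∑ r ∈ range a, u (r + p) * u (a + 1 - 1 - r + (b - 1 - p)) =
        ∑ p ∈ range b, ∑ r ∈ range a, u (r + p) * u (a - 1 - r + (b + 1 - 1 - p)) :=
      Finset.sum_congr rfl fun p hp => Finset.sum_congr rfl fun r hr => by
        have := Finset.mem_range.mp hp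
        have := Finset.mem_range.mp hr
        congr 2; lia
    rw [h1]
    simp [add_comm b]
  have hZ2 : ∑ r ∈ range (a + 1), z r * P (a + 1 - 1 - r) b -
      ∑ r ∈ range a, z r * P (a - 1 - r) (b + 1) =
      ∑ r ∈ range a, z r * Φ b (a - 1 - r) - ∑ r ∈ range a, z r * Φ (a - 1 - r) b := by
    rw [Finset.sum_range_succ, Nat.add_sub_cancel, Nat.sub_self, hP0, mul_zero, add_zero,
      ← Finset.sum_sub_distrib, ← Finset.sum_sub_distrib]
    refine Finset.sum_congr rfl fun r hr => ?_
    have := Finset.mem_range.mp hr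
    rw [← mul_sub, ← mul_sub, ← hP, show a - 1 - r + 1 = a - r by lia]
  calc _ = (P (a + 1) b - P a (b + 1)) + (Z (a + 1) b - Z a (b + 1)) -
        (U (a + 1) b - U a (b + 1)) -
        (∑ r ∈ range (a + 1), z r * P (a + 1 - 1 - r) b -
          ∑ r ∈ range a, z r * P (a - 1 - r) (b + 1)) := by rw [hX, hX]; abel
    _ = _ := by rw [hP, hZ, hU, hZ2]; abel

/-- The elements `tr (Eᵃ B)` commute, when the entries of the adjoint tensor `B` do. -/
lemma IsAdjointTensor.commute_trace_pow_mul [IsAddTorsionFree A] (hE : IsAdjointTensor E E)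
    (hB : IsAdjointTensor E B) (hBB : ∀ i j k l, Commute (B i j) (B k l)) (a b : ℕ) :
    Commute (E ^ a * B).trace (E ^ b * B).trace := by
  set z : ℕ → A := fun r => (E ^ r).trace
  set u : ℕ → A := fun r => (E ^ r * B).trace
  set Φ : ℕ → ℕ → A := fun p q => (E ^ p * B * (E ^ q * B)).trace
  have hd (a b : ℕ) : u a * u b - u b * u a = traceCommutator z u Φ a b :=
    hE.commutator_trace hB hBB a b
  have hanti (a b : ℕ) : traceCommutator z u Φ a b = -traceCommutator z u Φ b a := by
    rw [← hd, ← hd, neg_sub]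
  -- The difference of the two sides is symmetric in `a` and `b`, since a commutator is
  -- antisymmetric, and antisymmetric by `traceCommutator_succ_sub`. Twice it is therefore zero.
  -- Shifting then reduces everything to `b = 0`, where the sum is empty.
  have hstep (a b : ℕ) : traceCommutator z u Φ (a + 1) b = traceCommutator z u Φ a (b + 1) := by
    rw [← sub_eq_zero]
    have h1 := traceCommutator_succ_sub z u Φ a b
    have h2 := traceCommutator_succ_sub z u Φ b a
    have h3 : traceCommutator z u Φ (b + 1) a - traceCommutator z u Φ b (a + 1) =
        traceCommutator z u Φ (a + 1) b - traceCommutator z u Φ a (b + 1) := by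
      rw [hanti (b + 1) a, hanti b (a + 1)]; abel
    have h4 : 2 • (traceCommutator z u Φ (a + 1) b - traceCommutator z u Φ a (b + 1)) = 0 := by
      rw [two_nsmul]
      nth_rewrite 2 [← h3]
      rw [h1, h2]
      abel
    exact (smul_eq_zero.mp h4).resolve_left two_ne_zero
  have hzero (b : ℕ) : ∀ a, traceCommutator z u Φ a b = 0 := by
    induction b with
    | zero => intro a; simp [traceCommutator]
    | succ b ih => intro a; rw [← hstep, ih]
  exact sub_eq_zero.mp ((hd a b).trans (hzero b a))

end AdjointTensor


/-! ### The characteristic identity on a highest weight vector -/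

section HighestWeight

open Matrix Finset

variable {M : Type*} [AddCommGroup M] [Module ℂ M] {n : ℕ}
  {E Y B : Matrix (Fin n) (Fin n) (Module.End ℂ M)}

lemma IsAdjointTensor.aeval (hE : IsAdjointTensor E E) (p : ℂ[X]) :
    IsAdjointTensor E (Polynomial.aeval E p) := by
  induction p using Polynomial.induction_on' with
  | add p q hp hq =>
    intro i j k l
    have h := congrArg₂ (· + ·) (hp i j k l) (hq i j k l)
    simp only [map_add, Matrix.add_apply] at h ⊢
    rw [mul_add, add_mul, add_sub_add_comm, h]
    split_ifs <;> abel
  | monomial a c =>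
    intro i j k l
    have h := congrArg (c • ·) (hE.pow a i j k l)
    simp only [smul_sub] at h
    rw [aeval_monomial, ← Algebra.smul_def]
    simp only [Matrix.smul_apply, mul_smul_comm, smul_mul_assoc]
    rw [h]
    split_ifs <;> simp

/-- `v` is a highest weight vector of weight `w` for the operators `E`. -/
structure IsHighestWeight (E : Matrix (Fin n) (Fin n) (Module.End ℂ M)) (w : Fin n → ℂ) (v : M) :
    Prop where
  upper : ∀ i j, i < j → E i j v = 0
  diag : ∀ i, E i i v = w i • v

variable {w : Fin n → ℂ} {v : M}

/-- Expand column `j` of `p(E) E` on `v`. Entries `E l j` with `l < j` kill `v`, and `l = j` gives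
the weight. For `l > j`, moving `E l j` to the left leaves one extra `p(E) i j v` each, whence the
shift by the size of `Ioi j`. -/
lemma IsHighestWeight.aeval_recursion (hE : IsAdjointTensor E E) (hv : IsHighestWeight E w v)
    (p : ℂ[X]) (i j : Fin n) :
    Polynomial.aeval E (p * (X - C (w j + (Ioi j).card))) i j v =
      ∑ l ∈ Ioi j, (E l j (Polynomial.aeval E p i l v) -
        if j = i then Polynomial.aeval E p l l v else 0) := by
  set Q := Polynomial.aeval E p
  have h1 (l : Fin n) : Q i l (E l j v) = (if l = j then w j • Q i j v else 0) +
      if l ∈ Ioi j then (E l j (Q i l v) - if j = i then Q l l v else 0) + Q i j v else 0 := by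
    rcases lt_trichotomy l j with h | h | h
    · simp [hv.upper l j h, h.ne, h.le]
    · subst h; simp [hv.diag]
    · have := congrArg (fun T => T v) (hE.aeval p l j i l)
      simp only [LinearMap.sub_apply, Module.End.mul_apply, if_true] at this
      rw [if_neg h.ne', if_pos (Finset.mem_Ioi.mpr h), zero_add]
      have h2 : Q i l (E l j v) = E l j (Q i l v) - (E l j (Q i l v) - Q i l (E l j v)) := by abel
      rw [h2, this]
      split_ifs with h3
      · abel
      · simp [Q]
  have h2 : Polynomial.aeval E (p * (X - C (w j + (Ioi j).card))) i j v =
      ∑ l, Q i l (E l j v) - (w j + ((Ioi j).card : ℂ)) • Q i j v := by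
    rw [map_mul, map_sub, aeval_X, aeval_C, mul_sub, Matrix.sub_apply, Matrix.mul_apply,
      LinearMap.sub_apply, LinearMap.sum_apply]
    congr 1
    rw [← Algebra.commutes, ← Algebra.smul_def]
    rfl
  rw [h2]
  simp only [h1]
  rw [Finset.sum_add_distrib, Finset.sum_ite_eq' univ j, if_pos (Finset.mem_univ _),
    Finset.sum_ite_mem, Finset.univ_inter, Finset.sum_add_distrib, Finset.sum_const, add_smul,
    Nat.cast_smul_eq_nsmul]
  abel

/-- The characteristic identity: a monic polynomial in `E` of degree `n` kills the highest weight
vector. -/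
lemma IsHighestWeight.exists_monic_aeval_eq_zero (hE : IsAdjointTensor E E)
    (hv : IsHighestWeight E w v) : ∃ χ : ℂ[X], χ.Monic ∧ χ.natDegree = n ∧
      ∀ p, χ ∣ p → ∀ i j, Polynomial.aeval E p i j v = 0 := by
  let f (l : Fin n) : ℂ[X] := X - C (w l + (Ioi l).card)
  -- Induction on columns from the last one: the recursion expresses column `j` through columns `l >
  -- j`, so one new linear factor per column suffices.
  have key (j : Fin n) : ∀ p i, ∏ l ∈ Ici j, f l ∣ p → Polynomial.aeval E p i j v = 0 := by
    induction j using WellFoundedGT.induction with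
    | _ j ih =>
      rintro p i ⟨q, rfl⟩
      have h1 : (∏ l ∈ Ici j, f l) * q = ((∏ l ∈ Ioi j, f l) * q) * f j := by
        rw [← Finset.Ioi_insert, Finset.prod_insert (by simp)]
        ring
      rw [h1, hv.aeval_recursion hE]
      refine Finset.sum_eq_zero fun l hl => ?_
      have hdvd : ∏ l' ∈ Ici l, f l' ∣ (∏ l ∈ Ioi j, f l) * q :=
        Dvd.dvd.mul_right (Finset.prod_dvd_prod_of_subset _ _ _ fun l' hl' =>
          Finset.mem_Ioi.mpr ((Finset.mem_Ioi.mp hl).trans_le (Finset.mem_Ici.mp hl'))) q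
      rw [ih l (Finset.mem_Ioi.mp hl) _ _ hdvd, ih l (Finset.mem_Ioi.mp hl) _ _ hdvd]
      simp
  refine ⟨∏ l, f l, monic_prod_of_monic _ _ fun l _ => monic_X_sub_C _, ?_, fun p hp i j =>
    key j p i (dvd_trans (Finset.prod_dvd_prod_of_subset _ _ _ (Finset.subset_univ _)) hp)⟩
  rw [natDegree_prod_of_monic _ _ fun l _ => monic_X_sub_C _,
    Finset.sum_congr rfl fun l _ => natDegree_X_sub_C _]
  simp

/-- In the recursion for `p = X ^ a` all new terms involve columns further right. Those strictly
above the diagonal vanish on `v` by induction, and those on the diagonal are scalars. -/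
lemma IsHighestWeight.pow_apply (hE : IsAdjointTensor E E) (hv : IsHighestWeight E w v) (a : ℕ) :
    (∀ i j, i < j → (E ^ a) i j v = 0) ∧ ∀ i, ∃ c : ℂ, (E ^ a) i i v = c • v := by
  induction a with
  | zero =>
    refine ⟨fun i j h => by simp [h.ne], fun i => ⟨1, by simp⟩⟩
  | succ a ih =>
    choose c hc using ih.2
    have h1 (i j : Fin n) : (E ^ (a + 1)) i j v = (w j + ((Ioi j).card : ℂ)) • (E ^ a) i j v +
        ∑ l ∈ Ioi j, (E l j ((E ^ a) i l v) - if j = i then (E ^ a) l l v else 0) := by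
      have h := hv.aeval_recursion hE (X ^ a) i j
      rw [mul_sub, ← pow_succ, map_sub, map_mul, aeval_C, ← Algebra.commutes,
        ← Algebra.smul_def] at h
      simp only [map_pow, aeval_X, Matrix.sub_apply, LinearMap.sub_apply, Matrix.smul_apply,
        LinearMap.smul_apply] at h
      rw [← h]
      abel
    refine ⟨fun i j hij => ?_, fun i => ?_⟩
    · rw [h1, ih.1 i j hij, smul_zero, zero_add]
      refine Finset.sum_eq_zero fun l hl => ?_
      rw [ih.1 i l (hij.trans (Finset.mem_Ioi.mp hl)), map_zero, if_neg hij.ne', sub_zero]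
    · refine ⟨(w i + ((Ioi i).card : ℂ)) * c i - ∑ l ∈ Ioi i, c l, ?_⟩
      rw [h1, hc, sub_smul, mul_smul, Finset.sum_smul, sub_eq_add_neg, ← Finset.sum_neg_distrib]
      congr 1
      refine Finset.sum_congr rfl fun l hl => ?_
      rw [ih.1 i l (Finset.mem_Ioi.mp hl), map_zero, if_pos rfl, hc, zero_sub]

lemma IsHighestWeight.trace_pow (hE : IsAdjointTensor E E) (hv : IsHighestWeight E w v) (a : ℕ) :
    ∃ c : ℂ, (E ^ a).trace v = c • v := by
  choose c hc using (hv.pow_apply hE a).2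
  refine ⟨∑ i, c i, ?_⟩
  rw [Matrix.trace, LinearMap.sum_apply, Finset.sum_smul]
  exact Finset.sum_congr rfl fun i _ => hc i

/-- The operators `tr (Y p(E))` act on a highest weight vector through the class of `p` modulo the
characteristic polynomial. -/
lemma trace_mul_aeval_apply_eq_zero {p : ℂ[X]}
    (hp : ∀ i j, Polynomial.aeval E p i j v = 0) : (Y * Polynomial.aeval E p).trace v = 0 := by
  rw [Matrix.trace, LinearMap.sum_apply]
  refine Finset.sum_eq_zero fun i _ => ?_
  rw [Matrix.diag_apply, Matrix.mul_apply, LinearMap.sum_apply]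
  exact Finset.sum_eq_zero fun j _ => by rw [Module.End.mul_apply, hp, map_zero]

/-- Division by the characteristic polynomial leaves a remainder of degree below `n`. The polynomial
in `E` must act on `v` first, so the order inside the trace is reversed with
`IsAdjointTensor.trace_pow_mul` and restored afterwards. -/
lemma IsHighestWeight.exists_trace_pow_mul_eq_sum (hE : IsAdjointTensor E E)
    (hv : IsHighestWeight E w v) (hY : IsAdjointTensor E Y) (a : ℕ) :
    ∃ c : Fin n → ℂ, (E ^ a * Y).trace v = ∑ b : Fin n, c b • (E ^ (b : ℕ) * Y).trace v := by
  obtain ⟨χ, hχ, hdeg, hker⟩ := hv.exists_monic_aeval_eq_zero hE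
  refine ⟨fun b => (X ^ a %ₘ χ).coeff b, ?_⟩
  have h1 : (Y * Polynomial.aeval E (X ^ a - X ^ a %ₘ χ)).trace v = 0 := by
    refine trace_mul_aeval_apply_eq_zero (hker _ ?_)
    rw [modByMonic_eq_sub_mul_div, sub_sub_cancel]
    exact dvd_mul_right _ _
  have h2 : (X : ℂ[X]) ^ a %ₘ χ = ∑ b : Fin n, C ((X ^ a %ₘ χ).coeff b) * X ^ (b : ℕ) := by
    have hlt : (X ^ a %ₘ χ).degree < n := by
      refine (degree_modByMonic_lt _ hχ).trans_le ?_
      rw [← hdeg]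
      exact degree_le_natDegree
    rw [Polynomial.sum_fin (fun b c => C c * X ^ b) (by simp) hlt]
    exact (sum_C_mul_X_pow_eq _).symm
  rw [map_sub, mul_sub, Matrix.trace_sub, LinearMap.sub_apply, sub_eq_zero, map_pow, aeval_X,
    ← hE.trace_pow_mul hY] at h1
  rw [h1, h2, map_sum, Finset.mul_sum, Matrix.trace_sum, LinearMap.sum_apply]
  refine Finset.sum_congr rfl fun b _ => ?_
  rw [← h2, map_mul, aeval_C, map_pow, aeval_X, ← Algebra.smul_def, Matrix.mul_smul,
    Matrix.trace_smul, LinearMap.smul_apply, hE.trace_pow_mul hY]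

/-! ### The part of degree at most two. -/

section Graded

variable {W : Type*} [AddCommGroup W] [Module ℂ W] {G : ℕ → Submodule ℂ M}

/-- The span of the vectors of degree at most two obtained from `v` by the operators
`tr (Eᵃ B)` and `tr (Eᵃ B²)`, together with everything of degree at least three. -/
def lowDegreeSpan (E B : Matrix (Fin n) (Fin n) (Module.End ℂ M)) (G : ℕ → Submodule ℂ M) (v : M) :
    Submodule ℂ M :=
  Submodule.span ℂ ({v} ∪ {x | ∃ a, x = (E ^ a * B).trace v} ∪
    {x | (∃ a b, x = (E ^ a * B).trace ((E ^ b * B).trace v)) ∨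
      ∃ a, x = (E ^ a * B ^ 2).trace v} ∪ {x | ∃ d, 3 ≤ d ∧ x ∈ G d})

lemma trace_mul_mem {Y : Matrix (Fin n) (Fin n) (Module.End ℂ M)} {e : ℕ}
    (hY : ∀ i j d x, x ∈ G d → Y i j x ∈ G (d + e)) {d : ℕ} {x : M} (hx : x ∈ G d) :
    Y.trace x ∈ G (d + e) := by
  rw [Matrix.trace, LinearMap.sum_apply]
  exact sum_mem fun i _ => hY i i d x hx

lemma matrix_mul_mem {Y Z : Matrix (Fin n) (Fin n) (Module.End ℂ M)} {e e' : ℕ}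
    (hY : ∀ i j d x, x ∈ G d → Y i j x ∈ G (d + e))
    (hZ : ∀ i j d x, x ∈ G d → Z i j x ∈ G (d + e')) (i j : Fin n) (d : ℕ) (x : M)
    (hx : x ∈ G d) : (Y * Z) i j x ∈ G (d + (e' + e)) := by
  rw [Matrix.mul_apply, LinearMap.sum_apply, ← add_assoc]
  exact sum_mem fun k _ => hY _ _ _ _ (hZ _ _ _ _ hx)

lemma matrix_pow_mem {Y : Matrix (Fin n) (Fin n) (Module.End ℂ M)} {e : ℕ}
    (hY : ∀ i j d x, x ∈ G d → Y i j x ∈ G (d + e)) (a : ℕ) (i j : Fin n) (d : ℕ) (x : M)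
    (hx : x ∈ G d) : (Y ^ a) i j x ∈ G (d + a * e) := by
  induction a generalizing i j d x with
  | zero =>
    rw [pow_zero, Matrix.one_apply]
    split_ifs
    · simpa using hx
    · simp
  | succ a ih =>
    rw [pow_succ]
    have := matrix_mul_mem ih hY i j d x hx
    rwa [show e + a * e = (a + 1) * e by ring] at this

/-- For `b = 0` the operator commutes with the other traces, passes through to `v` and acts by a
scalar. For `b > 0` the degree rises by `b`: either the result is one of the listed vectors or it
has degree at least three. -/
lemma trace_pow_mul_pow_mem_lowDegreeSpan (hE : IsAdjointTensor E E) (hB : IsAdjointTensor E B)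
    (hv : IsHighestWeight E w v)
    (hEG : ∀ i j d x, x ∈ G d → E i j x ∈ G d) (hBG : ∀ i j d x, x ∈ G d → B i j x ∈ G (d + 1))
    (hvG : v ∈ G 0) (a b : ℕ) {x : M} (hx : x ∈ lowDegreeSpan E B G v) :
    (E ^ a * B ^ b).trace x ∈ lowDegreeSpan E B G v := by
  have hgr (a b d : ℕ) (x : M) (hx : x ∈ G d) : (E ^ a * B ^ b).trace x ∈ G (d + b) := by
    have h1 := matrix_mul_mem (matrix_pow_mem (e := 0) hEG a) (matrix_pow_mem (e := 1) hBG b)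
    have h2 := trace_mul_mem h1 hx
    simpa using h2
  have hgr1 (a d : ℕ) (x : M) (hx : x ∈ G d) : (E ^ a * B).trace x ∈ G (d + 1) := by
    simpa using hgr a 1 d x hx
  have hhigh {d : ℕ} {x : M} (hd : 3 ≤ d) (hx : x ∈ G d) : x ∈ lowDegreeSpan E B G v :=
    Submodule.subset_span (Or.inr ⟨d, hd, hx⟩)
  have hone (a : ℕ) : (E ^ a * B).trace v ∈ lowDegreeSpan E B G v :=
    Submodule.subset_span (Or.inl (Or.inl (Or.inr ⟨a, rfl⟩)))
  have htwo (a c : ℕ) : (E ^ a * B).trace ((E ^ c * B).trace v) ∈ lowDegreeSpan E B G v :=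
    Submodule.subset_span (Or.inl (Or.inr (Or.inl ⟨a, c, rfl⟩)))
  have htwo' (a : ℕ) : (E ^ a * B ^ 2).trace v ∈ lowDegreeSpan E B G v :=
    Submodule.subset_span (Or.inl (Or.inr (Or.inr ⟨a, rfl⟩)))
  have hcentral {Y : Matrix (Fin n) (Fin n) (Module.End ℂ M)} (hY : IsAdjointTensor E Y) (c : ℕ)
      (y : M) : (E ^ a).trace ((E ^ c * Y).trace y) = (E ^ c * Y).trace ((E ^ a).trace y) :=
    congrArg (fun T => T y) (commute_trace_pow (((hE.pow c).mul hY).commute_trace) a).eq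
  obtain ⟨z, hz⟩ := hv.trace_pow hE a
  induction hx using Submodule.span_induction with
  | zero => simp
  | add x y _ _ hx hy => rw [map_add]; exact add_mem hx hy
  | smul c x _ hx => rw [map_smul]; exact Submodule.smul_mem _ _ hx
  | mem x hx =>
    rcases hx with ((hx | ⟨c, rfl⟩) | (⟨c, e, rfl⟩ | ⟨c, rfl⟩)) | ⟨d, hd, hx⟩
    · rw [Set.mem_singleton_iff] at hx
      subst hx
      rcases b with _ | _ | _ | b
      · rw [pow_zero, mul_one, hz]
        exact Submodule.smul_mem _ _ (Submodule.subset_span (Or.inl (Or.inl (Or.inl rfl))))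
      · rw [zero_add, pow_one]; exact hone a
      · exact htwo' a
      · exact hhigh (by lia) (hgr _ _ _ _ hvG)
    · rcases b with _ | _ | b
      · rw [pow_zero, mul_one, hcentral hB, hz, map_smul]
        exact Submodule.smul_mem _ _ (hone c)
      · rw [zero_add, pow_one]; exact htwo a c
      · exact hhigh (by lia) (hgr _ _ _ _ (hgr1 _ _ _ hvG))
    · rcases b with _ | b
      · rw [pow_zero, mul_one, hcentral hB, hcentral hB, hz, map_smul, map_smul]
        exact Submodule.smul_mem _ _ (htwo c e)
      · exact hhigh (by lia) (hgr _ _ _ _ (hgr1 _ _ _ (hgr1 _ _ _ hvG)))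
    · rcases b with _ | b
      · rw [pow_zero, mul_one, hcentral (by rw [pow_two]; exact hB.mul hB), hz, map_smul]
        exact Submodule.smul_mem _ _ (htwo' c)
      · exact hhigh (by lia) (hgr _ _ _ _ (hgr _ _ _ _ hvG))
    · exact hhigh (by lia) (hgr _ _ _ _ hx)

/-- A functional that only sees degree two maps `lowDegreeSpan` to the span of finitely many
vectors. -/
lemma map_mem_span_of_mem_lowDegreeSpan (hE : IsAdjointTensor E E) (hB : IsAdjointTensor E B)
    (hBB : ∀ i j k l, Commute (B i j) (B k l)) (hv : IsHighestWeight E w v)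
    (hBG : ∀ i j d x, x ∈ G d → B i j x ∈ G (d + 1)) (hEG : ∀ i j d x, x ∈ G d → E i j x ∈ G d)
    (hvG : v ∈ G 0) (F : M →ₗ[ℂ] W) (hF : ∀ d ≠ 2, ∀ x ∈ G d, F x = 0) {x : M}
    (hx : x ∈ lowDegreeSpan E B G v) :
    F x ∈ Submodule.span ℂ (Set.range (Sum.elim
      (fun q : {q : Fin n × Fin n // q.1 ≤ q.2} =>
        F ((E ^ (q.1.1 : ℕ) * B).trace ((E ^ (q.1.2 : ℕ) * B).trace v)))
      (fun k : Fin n => F ((E ^ (k : ℕ) * B ^ 2).trace v)))) := by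
  set S := Submodule.span ℂ (Set.range (Sum.elim
      (fun q : {q : Fin n × Fin n // q.1 ≤ q.2} =>
        F ((E ^ (q.1.1 : ℕ) * B).trace ((E ^ (q.1.2 : ℕ) * B).trace v)))
      (fun k : Fin n => F ((E ^ (k : ℕ) * B ^ 2).trace v)))) with hS
  have hcomm (a b : ℕ) (y : M) : (E ^ a * B).trace ((E ^ b * B).trace y) =
      (E ^ b * B).trace ((E ^ a * B).trace y) := by
    have : IsAddTorsionFree (Module.End ℂ M) := IsAddTorsionFree.of_isTorsionFree ℂ _
    exact congrArg (fun T => T y) (hE.commute_trace_pow_mul hB hBB a b).eq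
  induction hx using Submodule.span_induction with
  | zero => simp
  | add x y _ _ hx hy => rw [map_add]; exact add_mem hx hy
  | smul c x _ hx => rw [map_smul]; exact Submodule.smul_mem _ _ hx
  | mem x hx =>
    rcases hx with ((hx | ⟨c, rfl⟩) | (⟨a, b, rfl⟩ | ⟨c, rfl⟩)) | ⟨d, hd, hx⟩
    · rw [Set.mem_singleton_iff] at hx
      subst hx
      rw [hF 0 (by lia) _ hvG]
      exact zero_mem _
    · have h1 := matrix_mul_mem (matrix_pow_mem (e := 0) hEG c) hBG
      rw [hF 1 (by lia) _ (by simpa using trace_mul_mem h1 hvG)]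
      exact zero_mem _
    -- The characteristic identity reduces only the operator applied directly to `v`. Commutativity
    -- of the `tr (Eᵃ B)` brings the other operator next to `v`, and also lets the exponents be
    -- sorted.
    · obtain ⟨c, hc⟩ := hv.exists_trace_pow_mul_eq_sum hE hB b
      obtain ⟨c', hc'⟩ := hv.exists_trace_pow_mul_eq_sum hE hB a
      rw [hc, map_sum, map_sum]
      refine sum_mem fun b' _ => ?_
      rw [map_smul, map_smul, hcomm, hc', map_sum, map_sum]
      refine Submodule.smul_mem _ _ (sum_mem fun a' _ => ?_)
      rw [map_smul, map_smul]
      refine Submodule.smul_mem _ _ ?_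
      rcases le_total a' b' with h | h
      · rw [hcomm]
        exact Submodule.subset_span ⟨.inl ⟨(a', b'), h⟩, rfl⟩
      · exact Submodule.subset_span ⟨.inl ⟨(b', a'), h⟩, rfl⟩
    · obtain ⟨c', hc'⟩ := hv.exists_trace_pow_mul_eq_sum hE (Y := B ^ 2)
        (by rw [pow_two]; exact hB.mul hB) c
      rw [hc', map_sum]
      refine sum_mem fun k _ => ?_
      rw [map_smul]
      exact Submodule.smul_mem _ _ (Submodule.subset_span ⟨.inr k, rfl⟩)
    · rw [hF d (by lia) _ hx]
      exact zero_mem _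

end Graded

end HighestWeight


/-! ### A polynomial model of the current algebra truncated at `t²` -/

section Model

attribute [local instance 100] LieRing.ofAssociativeRing

/-- Polynomials in the entries `x_{ia}` of a matrix acted on by left multiplication and the
entries `b_{kl}` of a matrix acted on by conjugation. -/
abbrev ModelRing (n : ℕ) : Type := MvPolynomial ((Fin n × Fin n) ⊕ (Fin n × Fin n)) ℂ

variable {n : ℕ}

/-- The variable `x_{ia}`. -/
def vecVar (i a : Fin n) : ModelRing n := MvPolynomial.X (.inl (i, a))

/-- The variable `b_{kl}`. -/
def matVar (k l : Fin n) : ModelRing n := MvPolynomial.X (.inr (k, l))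

/-- The linear form `∑ wᵢ x_{ia}`. -/
def vecForm (a : Fin n) : (Fin n → ℂ) →ₗ[ℂ] ModelRing n where
  toFun w := ∑ i, w i • vecVar i a
  map_add' v w := by simp [add_smul, Finset.sum_add_distrib]
  map_smul' c w := by simp [Finset.smul_sum, smul_smul]

/-- The linear form `∑ y_{kl} b_{kl}`. -/
def matForm : Gl n →ₗ[ℂ] ModelRing n where
  toFun y := ∑ k, ∑ l, y k l • matVar k l
  map_add' v w := by simp [add_smul, Finset.sum_add_distrib]
  map_smul' c w := by simp [Finset.smul_sum, smul_smul]

lemma vecForm_apply (a : Fin n) (w : Fin n → ℂ) : vecForm a w = ∑ i, w i • vecVar i a := rfl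

lemma matForm_apply (y : Gl n) : matForm y = ∑ k, ∑ l, y k l • matVar k l := rfl

lemma matForm_single (k l : Fin n) : matForm (Matrix.single k l 1) = matVar k l := by
  rw [matForm_apply, Finset.sum_eq_single k, Finset.sum_eq_single l]
  · simp
  · intro l' _ h; simp [h.symm]
  · simp
  · intro k' _ h; simp [h.symm]
  · simp

/-- The values on the variables of the derivation by which `gl(n)` acts. -/
def modelDerFun (x : Gl n) : (Fin n × Fin n) ⊕ (Fin n × Fin n) → ModelRing n :=
  Sum.elim (fun q => vecForm q.2 fun i => x i q.1)
    fun q => matForm (x * Matrix.single q.1 q.2 1 - Matrix.single q.1 q.2 1 * x)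

/-- The derivation by which `gl(n)` acts on the polynomial model. -/
def modelDer : Gl n →ₗ[ℂ] Derivation ℂ (ModelRing n) (ModelRing n) where
  toFun x := MvPolynomial.mkDerivation ℂ (modelDerFun x)
  map_add' x y := by
    refine MvPolynomial.derivation_ext fun s => ?_
    rw [Derivation.add_apply]
    simp only [MvPolynomial.mkDerivation_X]
    rcases s with ⟨i, a⟩ | ⟨k, l⟩
    · simp only [modelDerFun, Sum.elim_inl, ← map_add]
      rfl
    · simp only [modelDerFun, Sum.elim_inr, ← map_add]
      congr 1
      noncomm_ring
  map_smul' c x := by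
    refine MvPolynomial.derivation_ext fun s => ?_
    rw [Derivation.smul_apply]
    simp only [MvPolynomial.mkDerivation_X]
    rcases s with ⟨i, a⟩ | ⟨k, l⟩
    · simp only [modelDerFun, Sum.elim_inl, RingHom.id_apply, ← map_smul]
      rfl
    · simp only [modelDerFun, Sum.elim_inr, RingHom.id_apply, ← map_smul]
      congr 1
      rw [smul_sub, Matrix.mul_smul, Matrix.smul_mul]

lemma modelDer_vecVar (x : Gl n) (j a : Fin n) :
    modelDer x (vecVar j a) = vecForm a fun i => x i j :=
  MvPolynomial.mkDerivation_X _ _ _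

lemma modelDer_matVar (x : Gl n) (k l : Fin n) :
    modelDer x (matVar k l) = matForm (x * Matrix.single k l 1 - Matrix.single k l 1 * x) :=
  MvPolynomial.mkDerivation_X _ _ _

lemma modelDer_vecForm (x : Gl n) (a : Fin n) (w : Fin n → ℂ) :
    modelDer x (vecForm a w) = vecForm a (x.mulVec w) := by
  rw [vecForm_apply]
  simp only [map_sum, Derivation.map_smul, modelDer_vecVar]
  simp only [← map_smul, ← map_sum]
  congr 1
  ext i
  simp [Matrix.mulVec, dotProduct, Finset.sum_apply, mul_comm]

lemma modelDer_matForm (x y : Gl n) :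
    modelDer x (matForm y) = matForm (x * y - y * x) := by
  rw [matForm_apply]
  simp only [map_sum, Derivation.map_smul, modelDer_matVar]
  simp only [← map_smul, ← map_sum]
  congr 1
  conv_rhs => rw [Matrix.matrix_eq_sum_single y]
  simp only [Finset.mul_sum, Finset.sum_mul, ← Finset.sum_sub_distrib]
  refine Finset.sum_congr rfl fun k _ => Finset.sum_congr rfl fun l _ => ?_
  have : Matrix.single k l (y k l) = y k l • Matrix.single k l (1 : ℂ) := by simp
  rw [this, Matrix.mul_smul, Matrix.smul_mul, smul_sub]

lemma modelDer_commutator (x y : Gl n) (p : ModelRing n) :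
    modelDer (x * y - y * x) p = modelDer x (modelDer y p) - modelDer y (modelDer x p) := by
  have h : modelDer (x * y - y * x) = ⁅modelDer x, modelDer y⁆ := by
    refine MvPolynomial.derivation_ext fun s => ?_
    rw [Derivation.commutator_apply]
    rcases s with ⟨i, a⟩ | ⟨k, l⟩
    · change modelDer _ (vecVar i a) = modelDer x (modelDer y (vecVar i a)) -
        modelDer y (modelDer x (vecVar i a))
      simp only [modelDer_vecVar, modelDer_vecForm, ← map_sub]
      congr 1
    · change modelDer _ (matVar k l) = modelDer x (modelDer y (matVar k l)) -
        modelDer y (modelDer x (matVar k l))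
      simp only [modelDer_matVar, modelDer_matForm, ← map_sub]
      congr 1
      noncomm_ring
  rw [h, Derivation.commutator_apply]

/-- The action of `gl(n)[t]` on the polynomial model, through its quotient by `t²`. -/
def modelLin (n : ℕ) : CurrentGl n →ₗ[ℂ] Module.End ℂ (ModelRing n) :=
  TensorProduct.lift <| LinearMap.mk₂ ℂ
    (fun (P : ℂ[X]) (x : Gl n) => P.coeff 0 • (modelDer x : ModelRing n →ₗ[ℂ] ModelRing n) +
      P.coeff 1 • LinearMap.mulLeft ℂ (matForm x))
    (fun P Q x => by simp [add_smul]; abel)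
    (fun c P x => by simp [smul_smul])
    (fun P x y => LinearMap.ext fun p => by simp [add_mul]; abel)
    (fun c P x => LinearMap.ext fun p => by simp [smul_smul, mul_comm])

lemma modelLin_tmul_apply (P : ℂ[X]) (x : Gl n) (p : ModelRing n) :
    modelLin n (P ⊗ₜ x) p = P.coeff 0 • modelDer x p + P.coeff 1 • (matForm x * p) := rfl

/-- Only the coefficients of `1` and `t` act. Terms in `t · t` cancel because multiplications
commute, and the mixed terms are the Leibniz rule together with the conjugation action on the linear
forms in `b`. -/
lemma modelLin_tmul_lie (P Q : ℂ[X]) (x y : Gl n) :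
    modelLin n ((P * Q) ⊗ₜ ⁅x, y⁆) = modelLin n (P ⊗ₜ x) * modelLin n (Q ⊗ₜ y) -
      modelLin n (Q ⊗ₜ y) * modelLin n (P ⊗ₜ x) := by
  refine LinearMap.ext fun p => ?_
  have hc : (P * Q).coeff 1 = P.coeff 0 * Q.coeff 1 + P.coeff 1 * Q.coeff 0 := by
    rw [coeff_mul, Finset.Nat.antidiagonal_succ]
    simp
  have hb : ⁅x, y⁆ = x * y - y * x := rfl
  rw [modelLin_tmul_apply, hb, modelDer_commutator, ← modelDer_matForm, mul_coeff_zero, hc]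
  have hyx : modelDer y (matForm x) = - modelDer x (matForm y) := by
    rw [modelDer_matForm, modelDer_matForm, ← map_neg, neg_sub]
  rw [LinearMap.sub_apply, Module.End.mul_apply, Module.End.mul_apply]
  simp only [modelLin_tmul_apply, map_add, Derivation.map_smul, Derivation.leibniz,
    smul_eq_mul, hyx, smul_add, smul_sub, smul_smul, mul_smul_comm, add_smul,
    mul_neg, smul_neg]
  rw [mul_comm (Q.coeff 0) (P.coeff 0), mul_comm (Q.coeff 1) (P.coeff 0),
    mul_comm (Q.coeff 0) (P.coeff 1), mul_comm (Q.coeff 1) (P.coeff 1),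
    mul_left_comm (matForm x) (matForm y), mul_comm p]
  abel

/-- The Lie algebra map underlying `modelLin`. -/
def modelLie (n : ℕ) : CurrentGl n →ₗ⁅ℂ⁆ Module.End ℂ (ModelRing n) :=
  { modelLin n with
    map_lie' := fun {u v} => by
      change modelLin n ⁅u, v⁆ = modelLin n u * modelLin n v - modelLin n v * modelLin n u
      induction u using TensorProduct.induction_on with
      | zero =>
        refine (congrArg _ (zero_lie v)).trans ?_
        simp
      | add u u' hu hu' =>
        refine (congrArg _ (add_lie u u' v)).trans ?_
        rw [map_add, hu, hu', map_add]
        noncomm_ring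
      | tmul P x =>
        induction v using TensorProduct.induction_on with
        | zero =>
          refine (congrArg _ (lie_zero (P ⊗ₜ[ℂ] x : CurrentGl n))).trans ?_
          simp
        | add v v' hv hv' =>
          refine (congrArg _ (lie_add (P ⊗ₜ[ℂ] x : CurrentGl n) v v')).trans ?_
          rw [map_add, hv, hv', map_add]
          noncomm_ring
        | tmul Q y =>
          rw [LieAlgebra.ExtendScalars.bracket_tmul, modelLin_tmul_lie] }

/-- The action of `U(gl(n)[t])` on the polynomial model. -/
def modelHom (n : ℕ) : UCurrentGl n →ₐ[ℂ] Module.End ℂ (ModelRing n) :=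
  UniversalEnvelopingAlgebra.lift ℂ (modelLie n)

lemma modelHom_currentElt (x : Gl n) (P : ℂ[X]) :
    modelHom n (currentElt x P) = modelLin n (P ⊗ₜ x) := by
  unfold modelHom currentElt
  rw [UniversalEnvelopingAlgebra.lift_ι_apply]
  rfl

/-- The operators `E_{ij}` on the polynomial model. -/
def modelE (n : ℕ) : Matrix (Fin n) (Fin n) (Module.End ℂ (ModelRing n)) :=
  Matrix.of fun i j => (modelDer (Matrix.single i j 1) : ModelRing n →ₗ[ℂ] ModelRing n)

/-- Multiplication by the variables `b_{ij}`. -/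
def modelB (n : ℕ) : Matrix (Fin n) (Fin n) (Module.End ℂ (ModelRing n)) :=
  Matrix.of fun i j => LinearMap.mulLeft ℂ (matVar i j)

lemma modelE_apply (i j : Fin n) (p : ModelRing n) :
    modelE n i j p = modelDer (Matrix.single i j 1) p := rfl

lemma modelB_apply (i j : Fin n) (p : ModelRing n) : modelB n i j p = matVar i j * p := rfl

/-- The operators by which the generators `E_{ij}(m)` act on the polynomial model. -/
def modelMat (n m : ℕ) : Matrix (Fin n) (Fin n) (Module.End ℂ (ModelRing n)) :=
  if m = 0 then modelE n else if m = 1 then modelB n else 0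

lemma modelHom_unitElt (i j : Fin n) (m : ℕ) :
    modelHom n (currentElt (Matrix.single i j 1) (X ^ m)) = modelMat n m i j := by
  rw [modelHom_currentElt]
  refine LinearMap.ext fun p => ?_
  rw [modelLin_tmul_apply, modelMat, coeff_X_pow, coeff_X_pow, matForm_single]
  rcases m with _ | _ | m <;> simp [modelE_apply, modelB_apply]

lemma single_commutator (i j k l : Fin n) :
    (Matrix.single i j 1 * Matrix.single k l 1 - Matrix.single k l 1 * Matrix.single i j 1 : Gl n) =
      (if j = k then Matrix.single i l 1 else 0) - if i = l then Matrix.single k j 1 else 0 := by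
  congr 1
  · split_ifs with h
    · subst h; simp
    · rw [Matrix.single_mul_single_of_ne _ _ _ _ h]
  · split_ifs with h
    · subst h; simp
    · rw [Matrix.single_mul_single_of_ne _ _ _ _ (Ne.symm h)]

lemma isAdjointTensor_modelE : IsAdjointTensor (modelE n) (modelE n) := by
  intro i j k l
  refine LinearMap.ext fun p => ?_
  have := modelDer_commutator (Matrix.single i j 1) (Matrix.single k l 1) p
  rw [single_commutator] at this
  change modelDer _ (modelDer _ p) - modelDer _ (modelDer _ p) = _
  rw [← this]
  split_ifs <;> simp [modelE_apply]

lemma isAdjointTensor_modelB : IsAdjointTensor (modelE n) (modelB n) := by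
  intro i j k l
  refine LinearMap.ext fun p => ?_
  have := modelDer_matVar (Matrix.single i j 1) k l
  rw [single_commutator] at this
  change modelDer _ (matVar k l * p) - matVar k l * modelDer _ p = _
  rw [Derivation.leibniz, this, smul_eq_mul, smul_eq_mul, add_sub_cancel_left]
  split_ifs <;> simp [modelB_apply, matForm_single, mul_sub, mul_comm]

lemma commute_modelB (i j k l : Fin n) : Commute (modelB n i j) (modelB n k l) := by
  refine LinearMap.ext fun p => ?_
  change matVar i j * (matVar k l * p) = matVar k l * (matVar i j * p)
  ring

end Model


/-! ### The action of the cycle elements on the polynomial model -/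

section CycleAction

/-- Sum over paths from `p` to `q`: `Fin.cons` lists the row indices and `Fin.snoc` the column
indices. Closing the path in a trace turns the shift between the two into `finRotate`. -/
lemma prod_ofFn_matrix_apply {A ν : Type*} [Semiring A] [Fintype ν] [DecidableEq ν] {k : ℕ}
    (Y : Fin (k + 1) → Matrix ν ν A) (p q : ν) :
    (List.ofFn Y).prod p q = ∑ i : Fin k → ν, (List.ofFn fun j => Y j
      (Fin.cons (α := fun _ => ν) p i j) (Fin.snoc (α := fun _ => ν) i q j)).prod := by
  induction k generalizing p with
  | zero => simp [Fin.snoc]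
  | succ k ih =>
    rw [List.ofFn_succ, List.prod_cons, Matrix.mul_apply,
      ← (Fin.consEquiv fun _ => ν).sum_comp, Fintype.sum_prod_type]
    refine Finset.sum_congr rfl fun r _ => ?_
    rw [ih, Finset.mul_sum]
    refine Finset.sum_congr rfl fun i _ => ?_
    rw [List.ofFn_succ (f := fun j => Y j _ _), List.prod_cons]
    have h : (Fin.snoc (α := fun _ => ν) ((Fin.consEquiv fun _ => ν) (r, i)) q :
        Fin (k + 2) → ν) = Fin.cons r (Fin.snoc (α := fun _ => ν) i q) :=
      (Fin.cons_snoc_eq_snoc_cons (β := ν) r i q).symm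
    rw [h]
    simp only [Fin.consEquiv_apply, Fin.cons_zero, Fin.cons_succ]

lemma trace_prod_ofFn {A ν : Type*} [Semiring A] [Fintype ν] [DecidableEq ν] {k : ℕ}
    (Y : Fin (k + 1) → Matrix ν ν A) :
    (List.ofFn Y).prod.trace = ∑ i : Fin (k + 1) → ν,
      (List.ofFn fun j => Y j (i j) (i (finRotate _ j))).prod := by
  rw [← (Fin.consEquiv fun _ => ν).sum_comp, Fintype.sum_prod_type, Matrix.trace]
  refine Finset.sum_congr rfl fun p _ => ?_
  rw [Matrix.diag_apply, prod_ofFn_matrix_apply]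
  refine Finset.sum_congr rfl fun i _ => ?_
  simp only [Fin.consEquiv_apply, Fin.snoc_eq_cons_rotate]

variable {n : ℕ}

lemma modelHom_cycleElt {k : ℕ} (m : Fin (k + 1) → ℕ) :
    modelHom n (cycleElt n m) = (List.ofFn fun j => modelMat n (m j)).prod.trace := by
  rw [trace_prod_ofFn, cycleElt, map_sum]
  refine Finset.sum_congr rfl fun i _ => ?_
  rw [map_list_prod, List.map_ofFn]
  congr 2
  ext1 j
  exact modelHom_unitElt _ _ _

lemma prod_modelMat_of_pos {k : ℕ} (m : Fin k → ℕ) (hm : ∀ j, 1 ≤ m j) :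
    (List.ofFn fun j => modelMat n (m j)).prod = modelB n ^ k ∨
      (List.ofFn fun j => modelMat n (m j)).prod = 0 := by
  induction k with
  | zero => simp
  | succ k ih =>
    rw [List.ofFn_succ, List.prod_cons]
    by_cases h : m 0 = 1
    · rcases ih (fun j => m j.succ) fun j => hm _ with h' | h'
      · left
        rw [h', h, pow_succ']
        rfl
      · right
        rw [h', mul_zero]
    · right
      have := hm 0
      rw [modelMat, if_neg (by lia), if_neg h, zero_mul]

/-- With nondecreasing powers of `t`, all factors `E` precede all factors `B`, and any power above
one contributes zero. This is the only place where sortedness enters. -/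
lemma prod_modelMat_of_monotone {k : ℕ} (m : Fin k → ℕ) (hm : Monotone m) :
    (∃ a b, (List.ofFn fun j => modelMat n (m j)).prod = modelE n ^ a * modelB n ^ b) ∨
      (List.ofFn fun j => modelMat n (m j)).prod = 0 := by
  induction k with
  | zero => exact Or.inl ⟨0, 0, by simp⟩
  | succ k ih =>
    by_cases h : m 0 = 0
    · rw [List.ofFn_succ, List.prod_cons]
      rcases ih (fun j => m j.succ) (hm.comp (Fin.strictMono_succ).monotone) with ⟨a, b, h'⟩ | h'
      · refine Or.inl ⟨a + 1, b, ?_⟩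
        rw [h', h, pow_succ', mul_assoc]
        rfl
      · right
        rw [h', mul_zero]
    · rcases prod_modelMat_of_pos (n := n) m fun j => by
        have := hm (Fin.zero_le j)
        lia with h' | h'
      · exact Or.inl ⟨0, k + 1, by rw [h', pow_zero, one_mul]⟩
      · exact Or.inr h'

/-- The algebra generated by the cycle elements with nondecreasing powers of `t`. -/
def sortedCycleAlgebra (n : ℕ) : Subalgebra ℂ (UCurrentGl n) :=
  Algebra.adjoin ℂ {u : UCurrentGl n |
    ∃ (k : ℕ) (m : Fin k → ℕ), 1 ≤ k ∧ Monotone m ∧ u = cycleElt n m}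

/-- A subspace stable under all `tr (Eᵃ Bᵇ)` is stable under the sorted cycle algebra. -/
lemma modelHom_apply_mem {S : Submodule ℂ (ModelRing n)}
    (hS : ∀ a b, ∀ x ∈ S, (modelE n ^ a * modelB n ^ b).trace x ∈ S) {u : UCurrentGl n}
    (hu : u ∈ sortedCycleAlgebra n) {x : ModelRing n} (hx : x ∈ S) : modelHom n u x ∈ S := by
  induction hu using Algebra.adjoin_induction generalizing x with
  | mem u hu =>
    obtain ⟨k, m, hk, hm, rfl⟩ := hu
    obtain ⟨k, rfl⟩ : ∃ k', k = k' + 1 := ⟨k - 1, by lia⟩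
    rw [modelHom_cycleElt]
    rcases prod_modelMat_of_monotone (n := n) m hm with ⟨a, b, h⟩ | h
    · rw [h]; exact hS a b x hx
    · rw [h]; simp
  | algebraMap r =>
    rw [AlgHom.commutes, Module.algebraMap_end_apply]
    exact S.smul_mem _ hx
  | add u u' _ _ h h' => rw [map_add]; exact add_mem (h hx) (h' hx)
  | mul u u' _ _ h h' => rw [map_mul]; exact h (h' hx)

lemma modelHom_cycleElt_alternating : modelHom n (cycleElt n ![0, 1, 0, 1]) =
    (modelE n * modelB n * modelE n * modelB n).trace := by
  rw [modelHom_cycleElt]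
  simp [List.ofFn_succ, modelMat, mul_assoc]

end CycleAction


/-! ### Products of leading minors -/

section LeadingMinors

lemma Derivation.map_prod_eq_sum {R A ι : Type*} [CommRing R] [CommRing A] [Algebra R A]
    [DecidableEq ι] (d : Derivation R A A) (s : Finset ι) (f : ι → A) :
    d (∏ i ∈ s, f i) = ∑ j ∈ s, ∏ i ∈ s, if i = j then d (f i) else f i := by
  induction s using Finset.induction_on with
  | empty => simp
  | insert a s ha ih =>
    have h1 : ∏ i ∈ s, (if i = a then d (f i) else f i) = ∏ i ∈ s, f i :=
      Finset.prod_congr rfl fun i hi => if_neg (by rintro rfl; exact ha hi)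
    rw [Finset.prod_insert ha, d.leibniz, ih, Finset.sum_insert ha, Finset.prod_insert ha, h1,
      if_pos rfl, smul_eq_mul, smul_eq_mul, Finset.mul_sum, add_comm, mul_comm]
    congr 1
    refine Finset.sum_congr rfl fun j hj => ?_
    rw [Finset.prod_insert ha, if_neg (by rintro rfl; exact ha hj)]

lemma Derivation.map_det {R A ι : Type*} [CommRing R] [CommRing A] [Algebra R A] [Fintype ι]
    [DecidableEq ι] (d : Derivation R A A) (Y : Matrix ι ι A) :
    d Y.det = ∑ r, (Y.updateRow r fun a => d (Y r a)).det := by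
  simp only [Matrix.det_apply, map_sum]
  rw [Finset.sum_comm]
  refine Finset.sum_congr rfl fun σ _ => ?_
  have h (p : A) : d (Equiv.Perm.sign σ • p) = Equiv.Perm.sign σ • d p := by
    rcases Int.units_eq_one_or (Equiv.Perm.sign σ) with h | h <;> simp [h]
  rw [h, d.map_prod_eq_sum, ← Finset.smul_sum]
  congr 1
  refine (Finset.sum_congr rfl fun j _ => Finset.prod_congr rfl fun i _ => ?_).trans
    (Equiv.sum_comp σ fun r => ∏ i, Y.updateRow r (fun a => d (Y r a)) (σ i) i)
  by_cases hij : i = j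
  · subst hij; simp
  · rw [if_neg hij, Matrix.updateRow_ne (σ.injective.ne hij)]

variable {n : ℕ}

lemma modelE_vecVar (i j r a : Fin n) :
    modelDer (Matrix.single i j 1) (vecVar r a) = if r = j then vecVar i a else 0 := by
  rw [modelDer_vecVar, vecForm_apply]
  split_ifs with h
  · subst h
    rw [Finset.sum_eq_single i]
    · simp
    · intro b _ hb; simp [hb.symm]
    · simp
  · refine Finset.sum_eq_zero fun b _ => ?_
    simp [Ne.symm h]

/-- The rows of the matrix `x` up to the `m`-th, completed by rows of the identity. -/
def leadingMatrix (m : Fin n) : Matrix (Fin n) (Fin n) (ModelRing n) :=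
  Matrix.of fun i a => if i ≤ m then vecVar i a else (1 : Matrix (Fin n) (Fin n) (ModelRing n)) i a

/-- `E_{ij}` acts on the rows of `x`: it sends row `j` to row `i` and kills the other rows, and the
completing identity rows are constant. Raising operators thus produce a repeated row. -/
lemma modelDer_det_leadingMatrix (i j m : Fin n) :
    modelDer (Matrix.single i j 1) (leadingMatrix m).det =
      if j ≤ m then ((leadingMatrix m).updateRow j fun a => vecVar i a).det else 0 := by
  have h0 (r : Fin n) (hr : ¬ (r = j ∧ j ≤ m)) : ((leadingMatrix m).updateRow r fun a =>
      modelDer (Matrix.single i j 1) (leadingMatrix m r a)).det = 0 := by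
    refine Matrix.det_eq_zero_of_row_eq_zero r fun a => ?_
    rw [Matrix.updateRow_self, leadingMatrix, Matrix.of_apply]
    split_ifs with h
    · rw [modelE_vecVar, if_neg]
      rintro rfl
      exact hr ⟨rfl, h⟩
    · rw [Matrix.one_apply]
      split_ifs <;> simp
  rw [Derivation.map_det]
  split_ifs with h
  · rw [Finset.sum_eq_single j]
    · congr 2
      ext1 a
      rw [leadingMatrix, Matrix.of_apply, if_pos h, modelE_vecVar, if_pos rfl]
    · exact fun r _ hr => h0 r fun h' => hr h'.1
    · simp
  · exact Finset.sum_eq_zero fun r _ => h0 r fun h' => h h'.2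

lemma modelDer_det_leadingMatrix_of_lt {i j : Fin n} (hij : i < j) (m : Fin n) :
    modelDer (Matrix.single i j 1) (leadingMatrix m).det = 0 := by
  rw [modelDer_det_leadingMatrix]
  split_ifs with h
  · refine Matrix.det_zero_of_row_eq hij.ne ?_
    ext1 a
    rw [Matrix.updateRow_self, Matrix.updateRow_ne hij.ne, leadingMatrix, Matrix.of_apply,
      if_pos (hij.le.trans h)]
  · rfl

lemma modelDer_det_leadingMatrix_self (i m : Fin n) :
    modelDer (Matrix.single i i 1) (leadingMatrix m).det =
      if i ≤ m then (leadingMatrix m).det else 0 := by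
  rw [modelDer_det_leadingMatrix]
  split_ifs with h
  · congr 1
    refine (congrArg _ ?_).trans (Matrix.updateRow_eq_self (leadingMatrix m) i)
    ext1 a
    rw [leadingMatrix, Matrix.of_apply, if_pos h]
  · rfl

/-- The product of the leading minors of `x`. -/
def leadingProd (n : ℕ) : ModelRing n := ∏ m : Fin n, (leadingMatrix m).det

/-- The weight of `leadingProd`. -/
def leadingWeight (i : Fin n) : ℂ := (Finset.Ici i).card

lemma modelDer_leadingProd_of_lt {i j : Fin n} (hij : i < j) :
    modelDer (Matrix.single i j 1) (leadingProd n) = 0 := by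
  rw [leadingProd, Derivation.map_prod_eq_sum]
  exact Finset.sum_eq_zero fun m _ => Finset.prod_eq_zero (Finset.mem_univ m) (by
    rw [if_pos rfl, modelDer_det_leadingMatrix_of_lt hij])

lemma modelDer_leadingProd_self (i : Fin n) :
    modelDer (Matrix.single i i 1) (leadingProd n) = leadingWeight i • leadingProd n := by
  rw [leadingProd, Derivation.map_prod_eq_sum, leadingWeight, Nat.cast_smul_eq_nsmul,
    ← Finset.sum_const, ← Finset.sum_filter_add_sum_filter_not Finset.univ (fun m => i ≤ m),
    Finset.sum_eq_zero (s := Finset.univ.filter fun m => ¬ i ≤ m), add_zero]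
  · refine Finset.sum_congr (by ext; simp) fun m hm => Finset.prod_congr rfl fun r _ => ?_
    split_ifs with h
    · subst h
      rw [modelDer_det_leadingMatrix_self, if_pos (by simpa using hm)]
    · rfl
  · intro m hm
    refine Finset.prod_eq_zero (Finset.mem_univ m) ?_
    rw [if_pos rfl, modelDer_det_leadingMatrix_self, if_neg (by simpa using hm)]

lemma isHighestWeight_leadingProd_pow (s : ℕ) :
    IsHighestWeight (modelE n) (fun i => s * leadingWeight i) (leadingProd n ^ s) where
  upper i j hij := by
    rw [modelE_apply, Derivation.leibniz_pow, modelDer_leadingProd_of_lt hij]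
    simp
  diag i := by
    rw [modelE_apply, Derivation.leibniz_pow, modelDer_leadingProd_self]
    rcases s with _ | s
    · simp
    · rw [Nat.add_sub_cancel, smul_comm _ (leadingWeight i), smul_eq_mul, ← pow_succ,
        ← Nat.cast_smul_eq_nsmul ℂ, smul_smul]

/-! ### Grading and evaluation -/

/-- The substitution doubling the variables `b_{kl}`. -/
def doubleHom (n : ℕ) : ModelRing n →ₐ[ℂ] ModelRing n :=
  MvPolynomial.aeval (Sum.elim (fun q => vecVar q.1 q.2) fun q => (2 : ℂ) • matVar q.1 q.2)

lemma doubleHom_vecVar (i a : Fin n) : doubleHom n (vecVar i a) = vecVar i a :=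
  MvPolynomial.aeval_X _ _

lemma doubleHom_matVar (k l : Fin n) : doubleHom n (matVar k l) = (2 : ℂ) • matVar k l :=
  MvPolynomial.aeval_X _ _

/-- The polynomials of degree `d` in the variables `b_{kl}`. -/
def matDegree (n d : ℕ) : Submodule ℂ (ModelRing n) :=
  LinearMap.ker ((doubleHom n).toLinearMap - (2 : ℂ) ^ d • LinearMap.id)

lemma mem_matDegree {d : ℕ} {p : ModelRing n} :
    p ∈ matDegree n d ↔ doubleHom n p = (2 : ℂ) ^ d • p := by
  simp [matDegree, sub_eq_zero]

/-- `gl(n)` maps linear forms in `b` to linear forms in `b`, and likewise for `x`, so it commutes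
with rescaling `b`. -/
lemma doubleHom_modelDer (x : Gl n) (p : ModelRing n) :
    doubleHom n (modelDer x p) = modelDer x (doubleHom n p) := by
  induction p using MvPolynomial.induction_on with
  | C c =>
    have h : (MvPolynomial.C c : ModelRing n) = algebraMap ℂ _ c := rfl
    rw [h, Derivation.map_algebraMap, AlgHom.commutes, Derivation.map_algebraMap, map_zero]
  | add p q hp hq => simp only [map_add, hp, hq]
  | mul_X p s hp =>
    have hs : doubleHom n (modelDer x (MvPolynomial.X s)) =
        modelDer x (doubleHom n (MvPolynomial.X s)) := by
      rcases s with ⟨i, a⟩ | ⟨k, l⟩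
      · change doubleHom n (modelDer x (vecVar i a)) = modelDer x (doubleHom n (vecVar i a))
        rw [doubleHom_vecVar, modelDer_vecVar, vecForm_apply]
        simp only [map_sum, map_smul, doubleHom_vecVar]
      · change doubleHom n (modelDer x (matVar k l)) = modelDer x (doubleHom n (matVar k l))
        rw [doubleHom_matVar, Derivation.map_smul, modelDer_matVar, matForm_apply]
        simp only [map_sum, map_smul, doubleHom_matVar, Finset.smul_sum]
        refine Finset.sum_congr rfl fun _ _ => Finset.sum_congr rfl fun _ _ => ?_
        rw [smul_comm]
    simp only [Derivation.leibniz, map_add, map_mul, smul_eq_mul, hp, hs]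

lemma modelE_mem_matDegree (i j : Fin n) (d : ℕ) (p : ModelRing n) (hp : p ∈ matDegree n d) :
    modelE n i j p ∈ matDegree n d := by
  rw [mem_matDegree] at hp ⊢
  rw [modelE_apply, doubleHom_modelDer, hp, Derivation.map_smul]

lemma modelB_mem_matDegree (i j : Fin n) (d : ℕ) (p : ModelRing n) (hp : p ∈ matDegree n d) :
    modelB n i j p ∈ matDegree n (d + 1) := by
  rw [mem_matDegree] at hp ⊢
  rw [modelB_apply, map_mul, hp, doubleHom_matVar, smul_mul_smul_comm, pow_succ']

lemma leadingProd_pow_mem_matDegree (s : ℕ) : leadingProd n ^ s ∈ matDegree n 0 := by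
  have h (m : Fin n) : doubleHom n (leadingMatrix m).det = (leadingMatrix m).det := by
    rw [AlgHom.map_det]
    congr 1
    ext1 i a
    simp only [leadingMatrix, AlgHom.mapMatrix_apply, Matrix.map_apply, Matrix.of_apply,
      Matrix.one_apply]
    split_ifs <;> simp [doubleHom_vecVar]
  rw [mem_matDegree, map_pow, leadingProd, map_prod, pow_zero, one_smul]
  simp only [h]

/-- The substitution of the identity for `x` and of `β t` for `b`. -/
def evalHom (β : Gl n) : ModelRing n →ₐ[ℂ] ℂ[X] :=
  MvPolynomial.aeval (Sum.elim (fun q => (1 : Matrix (Fin n) (Fin n) ℂ[X]) q.1 q.2)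
    fun q => β q.1 q.2 • X)

lemma evalHom_vecVar (β : Gl n) (i a : Fin n) :
    evalHom β (vecVar i a) = (1 : Matrix (Fin n) (Fin n) ℂ[X]) i a :=
  MvPolynomial.aeval_X _ _

lemma evalHom_matVar (β : Gl n) (k l : Fin n) : evalHom β (matVar k l) = β k l • X :=
  MvPolynomial.aeval_X _ _

/-- The quadratic part in `b` of a polynomial, at the identity and at `β`. -/
def quadPart (β : Gl n) : ModelRing n →ₗ[ℂ] ℂ := Polynomial.lcoeff ℂ 2 ∘ₗ (evalHom β).toLinearMap

lemma quadPart_apply (β : Gl n) (p : ModelRing n) : quadPart β p = (evalHom β p).coeff 2 := rfl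

/-- Degree is recorded as an eigenvalue of the doubling substitution, and the powers of `2` are
distinct: an eigenvalue `2 ^ d` with `d ≠ 2` forces the coefficient of `X ^ 2` to vanish. -/
lemma quadPart_eq_zero (β : Gl n) {d : ℕ} (hd : d ≠ 2) {p : ModelRing n}
    (hp : p ∈ matDegree n d) : quadPart β p = 0 := by
  have h : (evalHom β).comp (doubleHom n) = (aeval (C (2 : ℂ) * X)).comp (evalHom β) := by
    refine MvPolynomial.algHom_ext fun s => ?_
    rcases s with ⟨i, a⟩ | ⟨k, l⟩
    · change evalHom β (doubleHom n (vecVar i a)) = aeval (C (2 : ℂ) * X) (evalHom β (vecVar i a))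
      rw [doubleHom_vecVar, evalHom_vecVar, Matrix.one_apply]
      split_ifs <;> simp
    · change evalHom β (doubleHom n (matVar k l)) = aeval (C (2 : ℂ) * X) (evalHom β (matVar k l))
      rw [doubleHom_matVar, map_smul, evalHom_matVar, map_smul, aeval_X, smul_comm,
        smul_eq_C_mul (2 : ℂ)]
  have h1 := congrArg (fun f => (f p).coeff 2) h
  simp only [AlgHom.comp_apply] at h1
  rw [mem_matDegree.mp hp, map_smul, coeff_smul, ← comp_eq_aeval, comp_C_mul_X_coeff,
    ← quadPart_apply, smul_eq_mul] at h1
  have h2 : ((2 : ℂ) ^ d - 2 ^ 2) * quadPart β p = 0 := by rw [sub_mul, h1]; ring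
  rcases mul_eq_zero.mp h2 with h3 | h3
  · refine absurd ?_ hd
    have h4 : ((2 ^ d : ℕ) : ℂ) = ((2 ^ 2 : ℕ) : ℂ) := by
      rw [Nat.cast_pow, Nat.cast_pow]
      exact sub_eq_zero.mp h3
    exact Nat.pow_right_injective le_rfl (Nat.cast_injective h4)
  · exact h3

lemma evalHom_leadingMatrix (β : Gl n) (m : Fin n) :
    (leadingMatrix m).map (evalHom β) = 1 := by
  ext1 i a
  rw [Matrix.map_apply, leadingMatrix, Matrix.of_apply]
  split_ifs
  · rw [evalHom_vecVar]
  · rw [Matrix.one_apply, Matrix.one_apply]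
    split_ifs <;> simp

lemma evalHom_leadingProd (β : Gl n) : evalHom β (leadingProd n) = 1 := by
  rw [leadingProd, map_prod]
  refine Finset.prod_eq_one fun m _ => ?_
  rw [AlgHom.map_det, AlgHom.mapMatrix_apply, evalHom_leadingMatrix, Matrix.det_one]

/-- At `x = 1` every leading matrix is the identity, so for `i ≠ j` replacing row `j` by row `i`
gives a repeated row. Hence the leading symbol of `E` is diagonal. -/
lemma evalHom_modelE_leadingProd (β : Gl n) (i j : Fin n) :
    evalHom β (modelE n i j (leadingProd n)) = Matrix.diagonal (fun i => C (leadingWeight i)) i j := by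
  by_cases hij : i = j
  · subst hij
    rw [modelE_apply, modelDer_leadingProd_self, map_smul, evalHom_leadingProd,
      Matrix.diagonal_apply_eq, smul_eq_C_mul, mul_one]
  · rw [modelE_apply, Matrix.diagonal_apply_ne _ hij, leadingProd, Derivation.map_prod_eq_sum,
      map_sum]
    refine Finset.sum_eq_zero fun m _ => ?_
    rw [map_prod]
    refine Finset.prod_eq_zero (Finset.mem_univ m) ?_
    rw [if_pos rfl, modelDer_det_leadingMatrix]
    split_ifs
    · rw [AlgHom.map_det, AlgHom.mapMatrix_apply, Matrix.map_updateRow, evalHom_leadingMatrix]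
      refine Matrix.det_zero_of_row_eq hij ?_
      ext1 a
      rw [Matrix.updateRow_self, Matrix.updateRow_ne hij]
      exact (evalHom_vecVar β i a).symm
    · simp

end LeadingMinors


/-! ### Asymptotics in the highest weight -/

section Symbols

open Filter Topology

section PolySeq

variable {V V' : Type*} [AddCommGroup V] [Module ℂ V] [AddCommGroup V'] [Module ℂ V']

/-- `q` is polynomial in `s` of degree at most `k`, with coefficient `r` of degree `k`. -/
def IsPolySeq (k : ℕ) (q : ℕ → V) (r : V) : Prop :=
  ∃ c : ℕ → V, ∀ s : ℕ, q s = (s : ℂ) ^ k • r + ∑ e ∈ Finset.range k, (s : ℂ) ^ e • c e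

lemma IsPolySeq.map {k : ℕ} {q : ℕ → V} {r : V} (h : IsPolySeq k q r) (T : V →ₗ[ℂ] V') :
    IsPolySeq k (fun s => T (q s)) (T r) := by
  obtain ⟨c, hc⟩ := h
  exact ⟨fun e => T (c e), fun s => by simp [hc]⟩

lemma IsPolySeq.add {k : ℕ} {q q' : ℕ → V} {r r' : V} (h : IsPolySeq k q r)
    (h' : IsPolySeq k q' r') : IsPolySeq k (fun s => q s + q' s) (r + r') := by
  obtain ⟨c, hc⟩ := h
  obtain ⟨c', hc'⟩ := h'
  refine ⟨fun e => c e + c' e, fun s => ?_⟩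
  simp only [hc, hc', smul_add, Finset.sum_add_distrib]
  abel

/-- Raising the degree bound makes the leading coefficient vanish; this is how lower-order terms are
discarded. -/
lemma IsPolySeq.succ {k : ℕ} {q : ℕ → V} {r : V} (h : IsPolySeq k q r) :
    IsPolySeq (k + 1) q 0 := by
  obtain ⟨c, hc⟩ := h
  refine ⟨fun e => if e = k then r else c e, fun s => ?_⟩
  dsimp only
  rw [Finset.sum_range_succ, if_pos rfl, smul_zero, zero_add, hc, add_comm]
  congr 1
  exact Finset.sum_congr rfl fun e he => by rw [if_neg (Finset.mem_range.mp he).ne]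

lemma IsPolySeq.smul {k : ℕ} {q : ℕ → V} {r : V} (h : IsPolySeq k q r) :
    IsPolySeq (k + 1) (fun s => (s : ℂ) • q s) r := by
  obtain ⟨c, hc⟩ := h
  refine ⟨fun e => if e = 0 then 0 else c (e - 1), fun s => ?_⟩
  dsimp only
  rw [Finset.sum_range_succ', hc, smul_add, smul_smul, ← pow_succ', Finset.smul_sum]
  simp [smul_smul, pow_succ']

lemma IsPolySeq.tendsto {k : ℕ} {q : ℕ → ℂ} {r : ℂ} (h : IsPolySeq k q r) :
    Tendsto (fun s : ℕ => ((s : ℂ) ^ k)⁻¹ * q s) atTop (𝓝 r) := by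
  obtain ⟨c, hc⟩ := h
  have h1 (e : ℕ) (he : e ∈ Finset.range k) :
      Tendsto (fun s : ℕ => ((s : ℂ)⁻¹) ^ (k - e) * c e) atTop (𝓝 0) := by
    have h2 : Tendsto (fun s : ℕ => ((s : ℂ)⁻¹)) atTop (𝓝 0) := tendsto_inv_atTop_nhds_zero_nat
    have h3 := (h2.pow (k - e)).mul_const (c e)
    rwa [zero_pow (by have := Finset.mem_range.mp he; lia), zero_mul] at h3
  have h4 := (tendsto_const_nhds (x := r) (f := atTop (α := ℕ))).add
    (tendsto_finsetSum (Finset.range k) h1)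
  rw [Finset.sum_const_zero, add_zero] at h4
  refine h4.congr' ?_
  filter_upwards [eventually_gt_atTop 0] with s hs
  have hs' : (s : ℂ) ≠ 0 := by exact_mod_cast hs.ne'
  rw [hc, mul_add, smul_eq_mul, inv_mul_cancel_left₀ (pow_ne_zero _ hs'), Finset.mul_sum]
  congr 1
  refine Finset.sum_congr rfl fun e he => ?_
  have he' := Finset.mem_range.mp he
  rw [smul_eq_mul, ← mul_assoc]
  congr 1
  rw [inv_pow, inv_eq_iff_eq_inv, mul_inv, inv_inv, eq_mul_inv_iff_mul_eq₀ (pow_ne_zero _ hs'),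
    ← pow_add]
  congr 1
  lia

end PolySeq

/-! ### Symbols along the powers of `leadingProd`. -/

variable {n : ℕ} {β : Gl n}

/-- `p s` is a power of `leadingProd` times a polynomial in `s` of degree at most `k`, whose
coefficient of degree `k` takes the value `t` at the identity and `β`. -/
def HasSymbol (β : Gl n) (k : ℕ) (p : ℕ → ModelRing n) (t : ℂ[X]) : Prop :=
  ∃ (N : ℕ) (q : ℕ → ModelRing n) (r : ModelRing n), IsPolySeq k q r ∧ evalHom β r = t ∧
    ∀ s, N ≤ s → p s = q s * leadingProd n ^ (s - N)

lemma hasSymbol_zero (k : ℕ) : HasSymbol β k (fun _ => 0) 0 :=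
  ⟨0, fun _ => 0, 0, ⟨fun _ => 0, by simp⟩, by simp, by simp⟩

lemma hasSymbol_leadingProd_pow : HasSymbol β 0 (fun s => leadingProd n ^ s) 1 :=
  ⟨0, fun _ => 1, 1, ⟨fun _ => 0, by simp⟩, by simp, by simp⟩

/-- Surplus powers of `leadingProd` can be absorbed into `q` without changing the symbol, since
`leadingProd` takes the value one at the identity. -/
lemma HasSymbol.exists_of_le {k N N' : ℕ} {p q : ℕ → ModelRing n} {r : ModelRing n}
    (hq : IsPolySeq k q r) (h : ∀ s, N ≤ s → p s = q s * leadingProd n ^ (s - N)) (hN : N ≤ N') :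
    ∃ q' r', IsPolySeq k q' r' ∧ evalHom β r' = evalHom β r ∧
      ∀ s, N' ≤ s → p s = q' s * leadingProd n ^ (s - N') := by
  refine ⟨_, _, hq.map (LinearMap.mulRight ℂ (leadingProd n ^ (N' - N))), ?_, fun s hs => ?_⟩
  · rw [LinearMap.mulRight_apply, map_mul, map_pow, evalHom_leadingProd, one_pow, mul_one]
  · rw [h s (hN.trans hs), LinearMap.mulRight_apply, mul_assoc, ← pow_add]
    congr 2
    lia

lemma HasSymbol.add {k : ℕ} {p p' : ℕ → ModelRing n} {t t' : ℂ[X]} (h : HasSymbol β k p t)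
    (h' : HasSymbol β k p' t') : HasSymbol β k (fun s => p s + p' s) (t + t') := by
  obtain ⟨N, q, r, hq, rfl, hp⟩ := h
  obtain ⟨N', q', r', hq', rfl, hp'⟩ := h'
  obtain ⟨q₁, r₁, hq₁, hr₁, hp₁⟩ :=
    HasSymbol.exists_of_le (β := β) hq hp (le_max_left N N')
  obtain ⟨q₂, r₂, hq₂, hr₂, hp₂⟩ :=
    HasSymbol.exists_of_le (β := β) hq' hp' (le_max_right N N')
  refine ⟨max N N', _, _, hq₁.add hq₂, by rw [map_add, hr₁, hr₂], fun s hs => ?_⟩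
  dsimp only
  rw [hp₁ s hs, hp₂ s hs, add_mul]

lemma HasSymbol.sum {ι : Type*} (S : Finset ι) {k : ℕ} {p : ι → ℕ → ModelRing n} {t : ι → ℂ[X]}
    (h : ∀ i, HasSymbol β k (p i) (t i)) :
    HasSymbol β k (fun s => ∑ i ∈ S, p i s) (∑ i ∈ S, t i) := by
  classical
  induction S using Finset.induction_on with
  | empty => simpa using hasSymbol_zero k
  | insert i S hi ih =>
    simp only [Finset.sum_insert hi]
    exact (h i).add ih

lemma HasSymbol.modelB_apply {k : ℕ} {p : ℕ → ModelRing n} {t : ℂ[X]} (h : HasSymbol β k p t)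
    (i j : Fin n) : HasSymbol β k (fun s => modelB n i j (p s)) ((β i j • X) * t) := by
  obtain ⟨N, q, r, hq, rfl, hp⟩ := h
  refine ⟨N, _, _, hq.map (modelB n i j), ?_, fun s hs => ?_⟩
  · rw [_root_.modelB_apply, map_mul, evalHom_matVar]
  · change matVar i j * p s = matVar i j * q s * _
    rw [hp s hs, mul_assoc]

/-- Differentiating `q s * leadingProd ^ (s - N)` brings down the factor `s - N` together with the
derivative of `leadingProd`. The term with `s` has one degree more and gives the symbol; the
derivative of `q s` and the term with `-N` are of lower order. One power of `leadingProd` is used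
up, hence `N + 1`. -/
lemma HasSymbol.modelE_apply {k : ℕ} {p : ℕ → ModelRing n} {t : ℂ[X]} (h : HasSymbol β k p t)
    (i j : Fin n) : HasSymbol β (k + 1) (fun s => modelE n i j (p s))
      (Matrix.diagonal (fun i => C (leadingWeight i)) i j * t) := by
  obtain ⟨N, q, r, hq, rfl, hp⟩ := h
  set W := modelE n i j (leadingProd n) with hW
  refine ⟨N + 1, _, _, ((((hq.map (modelE n i j)).map
    (LinearMap.mulRight ℂ (leadingProd n))).succ).add
      (hq.map (LinearMap.mulRight ℂ W)).smul).add
        ((hq.map (LinearMap.mulRight ℂ W)).map (-(N : ℂ) • LinearMap.id)).succ, ?_, fun s hs => ?_⟩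
  · rw [zero_add, add_zero, LinearMap.mulRight_apply, map_mul, hW, evalHom_modelE_leadingProd,
      mul_comm]
  · obtain ⟨s, rfl⟩ := Nat.exists_eq_add_of_le hs
    dsimp only
    rw [hp _ (by lia), show N + 1 + s - N = s + 1 by lia, show N + 1 + s - (N + 1) = s by lia,
      _root_.modelE_apply, Derivation.leibniz, Derivation.leibniz_pow, ← _root_.modelE_apply,
      ← _root_.modelE_apply,
      ← hW]
    simp only [LinearMap.mulRight_apply, LinearMap.smul_apply, LinearMap.id_apply, smul_eq_mul]
    simp only [Nat.add_sub_cancel, ← Nat.cast_smul_eq_nsmul ℂ, Algebra.smul_def, map_natCast,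
      map_neg]
    push_cast
    ring

/-- The operators `Y` act on symbols through the matrix `a`, raising the degree by `d`. -/
def HasMatrixSymbol (β : Gl n) (d : ℕ) (Y : Matrix (Fin n) (Fin n) (Module.End ℂ (ModelRing n)))
    (a : Matrix (Fin n) (Fin n) ℂ[X]) : Prop :=
  ∀ i j k p t, HasSymbol β k p t → HasSymbol β (k + d) (fun s => Y i j (p s)) (a i j * t)

lemma hasMatrixSymbol_modelE :
    HasMatrixSymbol β 1 (modelE n) (Matrix.diagonal fun i => C (leadingWeight i)) :=
  fun i j _ _ _ h => h.modelE_apply i j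

lemma hasMatrixSymbol_modelB : HasMatrixSymbol β 0 (modelB n) (β.map fun z => z • X) :=
  fun i j _ _ _ h => h.modelB_apply i j

variable {d d' : ℕ} {Y Y' : Matrix (Fin n) (Fin n) (Module.End ℂ (ModelRing n))}
  {a a' : Matrix (Fin n) (Fin n) ℂ[X]}

lemma HasMatrixSymbol.mul (h : HasMatrixSymbol β d Y a) (h' : HasMatrixSymbol β d' Y' a') :
    HasMatrixSymbol β (d' + d) (Y * Y') (a * a') := by
  intro i j k p t hp
  have := HasSymbol.sum Finset.univ fun l => h i l _ _ _ (h' l j _ _ _ hp)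
  simpa [Matrix.mul_apply, Finset.sum_mul, mul_assoc, add_assoc] using this

lemma HasMatrixSymbol.one : HasMatrixSymbol β 0 1 1 := by
  intro i j k p t hp
  by_cases hij : i = j
  · subst hij; simpa using hp
  · simpa [hij] using hasSymbol_zero k

lemma HasMatrixSymbol.pow (h : HasMatrixSymbol β d Y a) (e : ℕ) :
    HasMatrixSymbol β (e * d) (Y ^ e) (a ^ e) := by
  induction e with
  | zero => simpa using HasMatrixSymbol.one
  | succ e ih =>
    rw [pow_succ, pow_succ, add_mul, one_mul, add_comm]
    exact ih.mul h

lemma HasMatrixSymbol.trace (h : HasMatrixSymbol β d Y a) {k : ℕ} {p : ℕ → ModelRing n}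
    {t : ℂ[X]} (hp : HasSymbol β k p t) :
    HasSymbol β (k + d) (fun s => Y.trace (p s)) (a.trace * t) := by
  have := HasSymbol.sum Finset.univ fun i => h i i _ _ _ hp
  simpa [Matrix.trace, Finset.sum_mul] using this

lemma HasSymbol.tendsto {k : ℕ} {p : ℕ → ModelRing n} {t : ℂ[X]} (h : HasSymbol β k p t) :
    Tendsto (fun s : ℕ => ((s : ℂ) ^ k)⁻¹ * quadPart β (p s)) atTop (𝓝 (t.coeff 2)) := by
  obtain ⟨N, q, r, hq, rfl, hp⟩ := h
  refine (hq.map (quadPart β)).tendsto.congr' ?_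
  filter_upwards [eventually_ge_atTop N] with s hs
  rw [hp s hs, quadPart_apply, quadPart_apply, map_mul, map_pow, evalHom_leadingProd, one_pow,
    mul_one]

/-- The diagonal matrix of weights. -/
def weightMatrix (n : ℕ) : Gl n := Matrix.diagonal leadingWeight

lemma diagonal_C_pow (e : ℕ) : (Matrix.diagonal fun i : Fin n => C (leadingWeight i)) ^ e =
    (weightMatrix n ^ e).map C := by
  rw [weightMatrix, Matrix.diagonal_pow, Matrix.diagonal_pow, Matrix.diagonal_map (map_zero _)]
  congr 1
  ext1 i
  simp

lemma map_smul_X_eq (β : Gl n) : (β.map fun z => z • (X : ℂ[X])) = (X : ℂ[X]) • β.map C := by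
  ext1 i j
  rw [Matrix.map_apply, Matrix.smul_apply, Matrix.map_apply, smul_eq_C_mul, smul_eq_mul, mul_comm]

lemma trace_map_C (Z : Gl n) : (Z.map C).trace = C Z.trace := by
  simp [Matrix.trace]

lemma tendsto_quadPart_trace_mul_trace (β : Gl n) (a c : ℕ) :
    Tendsto (fun s : ℕ => ((s : ℂ) ^ (a + c))⁻¹ * quadPart β ((modelE n ^ a * modelB n).trace
      ((modelE n ^ c * modelB n).trace (leadingProd n ^ s)))) atTop
      (𝓝 ((weightMatrix n ^ a * β).trace * (weightMatrix n ^ c * β).trace)) := by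
  have h (e : ℕ) := (hasMatrixSymbol_modelE (β := β).pow e).mul hasMatrixSymbol_modelB
  have h1 := ((h a).trace ((h c).trace hasSymbol_leadingProd_pow)).tendsto
  rw [show 0 + (0 + c * 1) + (0 + a * 1) = a + c by ring] at h1
  convert h1 using 2
  · rw [diagonal_C_pow, diagonal_C_pow, map_smul_X_eq, Matrix.mul_smul, Matrix.mul_smul,
      Matrix.trace_smul, Matrix.trace_smul, ← Matrix.map_mul, ← Matrix.map_mul, trace_map_C,
      trace_map_C, smul_eq_mul, smul_eq_mul, mul_one,
      show ∀ z w : ℂ, X * C z * (X * C w) = C (z * w) * X ^ 2 by intro z w; rw [C_mul]; ring,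
      coeff_C_mul_X_pow, if_pos rfl]

lemma tendsto_quadPart_trace_mul_sq (β : Gl n) (a : ℕ) :
    Tendsto (fun s : ℕ => ((s : ℂ) ^ a)⁻¹ * quadPart β ((modelE n ^ a * modelB n ^ 2).trace
      (leadingProd n ^ s))) atTop (𝓝 ((weightMatrix n ^ a * (β * β)).trace)) := by
  have h := ((hasMatrixSymbol_modelE (β := β)).pow a).mul (hasMatrixSymbol_modelB.pow 2)
  have h1 := (h.trace hasSymbol_leadingProd_pow).tendsto
  rw [show 0 + (2 * 0 + a * 1) = a by ring] at h1
  convert h1 using 2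
  · rw [diagonal_C_pow, map_smul_X_eq, pow_two (X • _), Matrix.mul_smul, Matrix.smul_mul,
      Matrix.mul_smul, Matrix.mul_smul, Matrix.trace_smul, Matrix.trace_smul, ← Matrix.map_mul,
      ← Matrix.map_mul, trace_map_C, smul_eq_mul, smul_eq_mul, mul_one,
      show ∀ z : ℂ, X * (X * C z) = C z * X ^ 2 by intro z; ring,
      coeff_C_mul_X_pow, if_pos rfl]

lemma tendsto_quadPart_alternating (β : Gl n) :
    Tendsto (fun s : ℕ => ((s : ℂ) ^ 2)⁻¹ * quadPart β
      ((modelE n * modelB n * modelE n * modelB n).trace (leadingProd n ^ s))) atTop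
      (𝓝 ((weightMatrix n * β * weightMatrix n * β).trace)) := by
  have hE := hasMatrixSymbol_modelE (β := β)
  have hB := hasMatrixSymbol_modelB (β := β)
  have h1 := ((((hE.mul hB).mul hE).mul hB).trace hasSymbol_leadingProd_pow).tendsto
  convert h1 using 2
  · have := diagonal_C_pow (n := n) 1
    rw [pow_one, pow_one] at this
    rw [this, map_smul_X_eq]
    simp only [Matrix.mul_smul, Matrix.smul_mul, Matrix.trace_smul, ← Matrix.map_mul, trace_map_C]
    rw [smul_eq_mul, smul_eq_mul, mul_one,
      show ∀ z : ℂ, X * (X * C z) = C z * X ^ 2 by intro z; ring,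
      coeff_C_mul_X_pow, if_pos rfl]

end Symbols


/-! ### The sorted cycle elements do not generate -/

section LinearIndependence

open Filter Topology

variable {n : ℕ}

lemma diagonal_mul_single_one (w : Fin n → ℂ) (i j : Fin n) :
    Matrix.diagonal w * Matrix.single i j 1 = (Matrix.single i j (w i) : Gl n) := by
  ext p q
  rw [Matrix.diagonal_mul, Matrix.single_apply, Matrix.single_apply]
  split_ifs with h
  · rw [h.1, mul_one]
  · rw [mul_zero]

lemma weightMatrix_pow (a : ℕ) :
    weightMatrix n ^ a = Matrix.diagonal fun i => leadingWeight i ^ a := by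
  rw [weightMatrix, Matrix.diagonal_pow]
  rfl

/-- Distinct weights make the Vandermonde matrices used below invertible. -/
lemma leadingWeight_injective : Function.Injective (leadingWeight : Fin n → ℂ) := by
  intro i j h
  have h1 : ((Finset.Ici i).card : ℂ) = (Finset.Ici j).card := h
  rw [Nat.cast_inj, Fin.card_Ici, Fin.card_Ici] at h1
  ext
  lia

/-- The test matrices `E_{ij} + E_{ji}` and `E_{ii} + E_{jj}`. -/
def testMatrix (r : (Fin n × Fin n) × Bool) : Gl n :=
  if r.2 then Matrix.single r.1.1 r.1.1 1 + Matrix.single r.1.2 r.1.2 1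
  else Matrix.single r.1.1 r.1.2 1 + Matrix.single r.1.2 r.1.1 1

lemma trace_testMatrix_offDiag {i j : Fin n} (hij : i ≠ j) (a : ℕ) :
    (weightMatrix n ^ a * testMatrix ((i, j), false)).trace = 0 := by
  rw [weightMatrix_pow]
  simp [testMatrix, mul_add, diagonal_mul_single_one, Matrix.trace_single_eq_of_ne _ _ _ hij,
    Matrix.trace_single_eq_of_ne _ _ _ hij.symm]

lemma trace_testMatrix_diag (i j : Fin n) (a : ℕ) :
    (weightMatrix n ^ a * testMatrix ((i, j), true)).trace =
      leadingWeight i ^ a + leadingWeight j ^ a := by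
  rw [weightMatrix_pow]
  simp [testMatrix, mul_add, diagonal_mul_single_one]

lemma trace_testMatrix_sq {i j : Fin n} (hij : i ≠ j) (a : ℕ) :
    (weightMatrix n ^ a * (testMatrix ((i, j), false) * testMatrix ((i, j), false))).trace =
      leadingWeight i ^ a + leadingWeight j ^ a := by
  rw [weightMatrix_pow]
  simp [testMatrix, mul_add, add_mul, diagonal_mul_single_one,
    Matrix.single_mul_single_of_ne _ _ _ _ hij, Matrix.single_mul_single_of_ne _ _ _ _ hij.symm,
    add_comm]

lemma trace_testMatrix_alternating {i j : Fin n} (hij : i ≠ j) :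
    (weightMatrix n * testMatrix ((i, j), false) * weightMatrix n *
      testMatrix ((i, j), false)).trace = 2 * leadingWeight i * leadingWeight j := by
  have h : weightMatrix n * testMatrix ((i, j), false) =
      Matrix.single i j (leadingWeight i) + Matrix.single j i (leadingWeight j) := by
    have hw : weightMatrix n = Matrix.diagonal leadingWeight := rfl
    have ht : testMatrix ((i, j), false) = (Matrix.single i j 1 + Matrix.single j i 1 : Gl n) := rfl
    rw [hw, ht, Matrix.mul_add, diagonal_mul_single_one, diagonal_mul_single_one]
  rw [mul_assoc _ (weightMatrix n), h]
  simp [mul_add, add_mul, Matrix.single_mul_single_of_ne _ _ _ _ hij,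
    Matrix.single_mul_single_of_ne _ _ _ _ hij.symm]
  ring

/-- The indices of the products of traces and of the traces with a square. -/
abbrev TraceIndex (n : ℕ) : Type := {q : Fin n × Fin n // q.1 ≤ q.2} ⊕ Fin n

/-- The limits of the quadratic parts, as functions on the test matrices. -/
def classicalVec (o : Option (TraceIndex n)) (r : (Fin n × Fin n) × Bool) : ℂ :=
  o.casesOn' ((weightMatrix n * testMatrix r * weightMatrix n * testMatrix r).trace)
    (Sum.elim (fun q => (weightMatrix n ^ (q.1.1 : ℕ) * testMatrix r).trace *
        (weightMatrix n ^ (q.1.2 : ℕ) * testMatrix r).trace)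
      fun k => (weightMatrix n ^ (k : ℕ) * (testMatrix r * testMatrix r)).trace)

/-- Four distinct indices are needed to eliminate `f`: in the combination of the pairs `01 + 23 - 02
- 13` it cancels, and the rest factors as `2 e (α₀ - α₃)(α₁ - α₂)`. With `e = 0`, three indices
recover each `f i`. -/
lemma eq_zero_of_add_add_eq_zero (hn : 4 ≤ n) {α f : Fin n → ℂ} (hα : Function.Injective α) {e : ℂ}
    (h : ∀ i j, i ≠ j → f i + f j + e * (2 * α i * α j) = 0) : e = 0 ∧ f = 0 := by
  have he : e = 0 := by
    let z (i : ℕ) (hi : i < 4) : Fin n := ⟨i, by lia⟩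
    have hne (i j : ℕ) (hi : i < 4) (hj : j < 4) (hij : i ≠ j) : z i hi ≠ z j hj := by
      intro h'
      exact hij (congrArg Fin.val h')
    have h1 := h _ _ (hne 0 1 (by lia) (by lia) (by lia))
    have h2 := h _ _ (hne 2 3 (by lia) (by lia) (by lia))
    have h3 := h _ _ (hne 0 2 (by lia) (by lia) (by lia))
    have h4 := h _ _ (hne 1 3 (by lia) (by lia) (by lia))
    have h5 : e * ((α (z 0 (by lia)) - α (z 3 (by lia))) *
        (α (z 1 (by lia)) - α (z 2 (by lia)))) = 0 := by
      linear_combination (h1 + h2 - h3 - h4) / 2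
    refine (mul_eq_zero.mp h5).resolve_right (mul_ne_zero ?_ ?_)
    · exact sub_ne_zero.mpr (hα.ne (hne 0 3 (by lia) (by lia) (by lia)))
    · exact sub_ne_zero.mpr (hα.ne (hne 1 2 (by lia) (by lia) (by lia)))
  refine ⟨he, funext fun i => ?_⟩
  subst he
  obtain ⟨j, hj⟩ : ∃ j : Fin n, j ∉ ({i} : Finset (Fin n)) := by
    by_contra! h'
    have := Finset.card_le_card (fun x _ => h' x : Finset.univ ⊆ {i})
    rw [Finset.card_univ, Fintype.card_fin, Finset.card_singleton] at this
    lia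
  obtain ⟨k, hk⟩ : ∃ k : Fin n, k ∉ ({i, j} : Finset (Fin n)) := by
    by_contra! h'
    have := (Finset.card_le_card (fun x _ => h' x : Finset.univ ⊆ {i, j})).trans
      Finset.card_le_two
    rw [Finset.card_univ, Fintype.card_fin] at this
    lia
  simp only [Finset.mem_singleton, Finset.mem_insert, not_or] at hj hk
  have h1 := h i j (Ne.symm hj)
  have h2 := h i k (Ne.symm hk.1)
  have h3 := h j k (Ne.symm hk.2)
  rw [Pi.zero_apply]
  linear_combination (h1 + h2 - h3) / 2

/-- Taking `i = j` and then polarizing isolates the symmetric bilinear part. Two applications of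
Vandermonde, one in each variable, kill `c a b + c b a`, and triangularity of `c` separates the two
terms. -/
lemma eq_zero_of_quadratic_form {α : Fin n → ℂ} (hα : Function.Injective α)
    {c : Fin n → Fin n → ℂ} (hc : ∀ a b, ¬ a ≤ b → c a b = 0)
    (h : ∀ i j, ∑ a, ∑ b, c a b * ((α i ^ (a : ℕ) + α j ^ (a : ℕ)) *
      (α i ^ (b : ℕ) + α j ^ (b : ℕ))) = 0) (a b : Fin n) (hab : a ≤ b) : c a b = 0 := by
  let P (x y : ℂ) : ℂ := ∑ a, ∑ b, c a b * (x ^ (a : ℕ) * y ^ (b : ℕ))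
  have h1 (i j : Fin n) : P (α i) (α i) + P (α i) (α j) + P (α j) (α i) + P (α j) (α j) = 0 := by
    rw [← h i j]
    simp only [P, ← Finset.sum_add_distrib]
    refine Finset.sum_congr rfl fun a _ => Finset.sum_congr rfl fun b _ => ?_
    ring
  have h2 (i : Fin n) : P (α i) (α i) = 0 := by linear_combination h1 i i / 4
  have h3 (i j : Fin n) : ∑ a : Fin n, α i ^ (a : ℕ) * ∑ b : Fin n, α j ^ (b : ℕ) * (c a b + c b a) = 0 := by
    have h4 : P (α i) (α j) + P (α j) (α i) = 0 := by
      linear_combination h1 i j - h2 i - h2 j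
    have h5 : P (α j) (α i) = ∑ a, ∑ b, c b a * (α j ^ (b : ℕ) * α i ^ (a : ℕ)) :=
      Finset.sum_comm
    rw [← h4, h5]
    simp only [P, ← Finset.sum_add_distrib, Finset.mul_sum]
    refine Finset.sum_congr rfl fun a _ => Finset.sum_congr rfl fun b _ => ?_
    ring
  have h4 (j a : Fin n) : ∑ b : Fin n, α j ^ (b : ℕ) * (c a b + c b a) = 0 :=
    congrFun (Matrix.eq_zero_of_forall_index_sum_pow_mul_eq_zero (v := fun a =>
      ∑ b : Fin n, α j ^ (b : ℕ) * (c a b + c b a)) hα fun i => h3 i j) a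
  have h5 : c a b + c b a = 0 :=
    congrFun (Matrix.eq_zero_of_forall_index_sum_pow_mul_eq_zero (v := fun b =>
      c a b + c b a) hα fun j => h4 j a) b
  rcases hab.eq_or_lt with rfl | hlt
  · linear_combination h5 / 2
  · rwa [hc b a (not_le.mpr hlt), add_zero] at h5

lemma linearIndependent_classicalVec (hn : 4 ≤ n) :
    LinearIndependent ℂ (classicalVec : Option (TraceIndex n) → _) := by
  rw [Fintype.linearIndependent_iff]
  intro g hg
  have hg' (r : (Fin n × Fin n) × Bool) := congrFun hg r
  simp only [Fintype.sum_option, Fintype.sum_sum_type, Finset.sum_apply,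
    Pi.smul_apply, smul_eq_mul, Pi.zero_apply, classicalVec, Option.casesOn'_none,
    Option.casesOn'_some, Sum.elim_inl, Sum.elim_inr] at hg'
  -- On `E_{ij} + E_{ji}` with `i ≠ j` all products of traces vanish, which isolates the
  -- coefficients of the traces with a square and of the alternating trace. The matrices `E_{ii} +
  -- E_{jj}` then handle the products.
  obtain ⟨he, hf⟩ := eq_zero_of_add_add_eq_zero hn leadingWeight_injective (e := g none)
      (f := fun i => ∑ k : Fin n, g (some (.inr k)) * leadingWeight i ^ (k : ℕ)) fun i j hij => by
    have h := hg' ((i, j), false)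
    simp only [trace_testMatrix_alternating hij, trace_testMatrix_sq hij,
      trace_testMatrix_offDiag hij, mul_zero, Finset.sum_const_zero, zero_add, mul_add,
      Finset.sum_add_distrib] at h
    linear_combination h
  have hd : (fun k : Fin n => g (some (.inr k))) = 0 :=
    Matrix.eq_zero_of_forall_index_sum_mul_pow_eq_zero leadingWeight_injective fun i => congrFun hf i
  have hd' (k : Fin n) : g (some (.inr k)) = 0 := congrFun hd k
  let c (a b : Fin n) : ℂ := if h : a ≤ b then g (some (.inl ⟨(a, b), h⟩)) else 0
  have hc := eq_zero_of_quadratic_form leadingWeight_injective (c := c)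
    (fun a b hab => dif_neg hab) fun i j => by
    have h := hg' ((i, j), true)
    simp only [trace_testMatrix_diag, he, hd', zero_mul, Finset.sum_const_zero, zero_add,
      add_zero] at h
    rw [← h, ← Fintype.sum_prod_type' (f := fun a b : Fin n => c a b *
      ((leadingWeight i ^ (a : ℕ) + leadingWeight j ^ (a : ℕ)) *
      (leadingWeight i ^ (b : ℕ) + leadingWeight j ^ (b : ℕ)))),
      ← Finset.sum_subset (Finset.subset_univ (Finset.univ.filter fun q : Fin n × Fin n =>
        q.1 ≤ q.2)), Finset.sum_subtype (p := fun q : Fin n × Fin n => q.1 ≤ q.2) _ (by simp)]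
    · refine Finset.sum_congr rfl fun q _ => ?_
      simp only [c]
      rw [dif_pos q.2]
    · intro q _ hq
      simp only [c]
      rw [dif_neg (by simpa using hq), zero_mul]
  rintro (_ | ⟨q, hq⟩ | k)
  · exact he
  · have := hc q.1 q.2 hq
    simp only [c] at this
    rwa [dif_pos hq] at this
  · exact hd' k

/-- The quadratic parts at all test matrices. -/
def quadVec (n : ℕ) : ModelRing n →ₗ[ℂ] (Fin n × Fin n) × Bool → ℂ :=
  LinearMap.pi fun r => quadPart (testMatrix r)

/-- The rescaled quadratic parts of the vectors of degree two obtained from the highest weight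
vector of weight proportional to `s`. -/
def quantumVec (s : ℕ) (o : Option (TraceIndex n)) : (Fin n × Fin n) × Bool → ℂ :=
  o.casesOn' (((s : ℂ) ^ 2)⁻¹ • quadVec n
      ((modelE n * modelB n * modelE n * modelB n).trace (leadingProd n ^ s)))
    (Sum.elim (fun q => ((s : ℂ) ^ ((q.1.1 : ℕ) + (q.1.2 : ℕ)))⁻¹ • quadVec n
        ((modelE n ^ (q.1.1 : ℕ) * modelB n).trace
          ((modelE n ^ (q.1.2 : ℕ) * modelB n).trace (leadingProd n ^ s))))
      fun k => ((s : ℂ) ^ (k : ℕ))⁻¹ • quadVec n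
        ((modelE n ^ (k : ℕ) * modelB n ^ 2).trace (leadingProd n ^ s)))

lemma tendsto_quantumVec : Tendsto (quantumVec (n := n)) atTop (𝓝 classicalVec) := by
  rw [tendsto_pi_nhds]
  intro o
  rw [tendsto_pi_nhds]
  intro r
  rcases o with _ | q | k
  · exact tendsto_quadPart_alternating (testMatrix r)
  · exact tendsto_quadPart_trace_mul_trace (testMatrix r) _ _
  · exact tendsto_quadPart_trace_mul_sq (testMatrix r) _

/-- Linear independence of a finite family is an open condition, so it passes from the limit to
large `s`. -/
lemma exists_linearIndependent_quantumVec (hn : 4 ≤ n) :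
    ∃ s : ℕ, 0 < s ∧ LinearIndependent ℂ (quantumVec (n := n) s) := by
  have h := tendsto_quantumVec.eventually
    (isOpen_setOfPred_linearIndependent.mem_nhds (linearIndependent_classicalVec hn))
  obtain ⟨s, hs, hs'⟩ := ((eventually_gt_atTop 0).and h).exists
  exact ⟨s, hs, hs'⟩

/-- The sorted algebra maps `v` into `lowDegreeSpan`, whose quadratic parts are spanned by the
listed vectors. The rescaling by powers of `s` is harmless because `s ≠ 0`. -/
lemma quantumVec_none_mem_span (s : ℕ) (hs : 0 < s)
    (hz : cycleElt n ![0, 1, 0, 1] ∈ sortedCycleAlgebra n) :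
    quantumVec (n := n) s none ∈ Submodule.span ℂ (Set.range fun i => quantumVec (n := n) s (some i)) := by
  have hv := isHighestWeight_leadingProd_pow (n := n) s
  have hv0 := leadingProd_pow_mem_matDegree (n := n) s
  have hmem := modelHom_apply_mem (S := lowDegreeSpan (modelE n) (modelB n) (matDegree n)
    (leadingProd n ^ s)) (fun a b x hx => trace_pow_mul_pow_mem_lowDegreeSpan
      isAdjointTensor_modelE isAdjointTensor_modelB hv modelE_mem_matDegree modelB_mem_matDegree
      hv0 a b hx) hz (x := leadingProd n ^ s)
    (Submodule.subset_span (Or.inl (Or.inl (Or.inl rfl))))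
  rw [modelHom_cycleElt_alternating] at hmem
  have h := map_mem_span_of_mem_lowDegreeSpan isAdjointTensor_modelE isAdjointTensor_modelB
    commute_modelB hv modelB_mem_matDegree modelE_mem_matDegree hv0 (quadVec n)
    (fun d hd x hx => funext fun r => quadPart_eq_zero _ hd hx) hmem
  refine Submodule.smul_mem _ _ (Submodule.span_le.mpr ?_ h)
  have hs' : (s : ℂ) ≠ 0 := by exact_mod_cast hs.ne'
  have key (e : ℕ) (i : TraceIndex n) (x : (Fin n × Fin n) × Bool → ℂ)
      (hx : quantumVec s (some i) = ((s : ℂ) ^ e)⁻¹ • x) :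
      x ∈ Submodule.span ℂ (Set.range fun i => quantumVec (n := n) s (some i)) := by
    have h1 : x = (s : ℂ) ^ e • quantumVec s (some i) := by
      rw [hx, smul_inv_smul₀ (pow_ne_zero _ hs')]
    rw [h1]
    exact Submodule.smul_mem _ _ (Submodule.subset_span ⟨i, rfl⟩)
  rintro _ ⟨q | k, rfl⟩
  · exact key _ (.inl q) _ rfl
  · exact key _ (.inr k) _ rfl

/-- The alternating cycle element is not in the sorted cycle algebra. -/
theorem cycleElt_alternating_notMem (hn : 4 ≤ n) :
    cycleElt n ![0, 1, 0, 1] ∉ sortedCycleAlgebra n := by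
  intro hz
  obtain ⟨s, hs, hli⟩ := exists_linearIndependent_quantumVec hn
  have h : LinearIndependent ℂ (fun o : Option (TraceIndex n) =>
      o.casesOn' (quantumVec s none) fun i => quantumVec s (some i)) := by
    convert hli using 1
    ext1 o
    cases o <;> rfl
  exact (linearIndependent_option'.mp h).2 (quantumVec_none_mem_span s hs hz)

theorem sortedCycleAlgebra_ne_glInvariants (hn : 4 ≤ n) :
    sortedCycleAlgebra n ≠ glInvariants n := by
  intro h
  refine cycleElt_alternating_notMem hn ?_
  rw [h, ← cycleAlgebra_eq_glInvariants]
  exact Algebra.subset_adjoin ⟨4, _, by lia, rfl⟩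

end LinearIndependence
end

theorem mainTheorem5 (n : ℕ) :
    Algebra.adjoin ℂ {u : UCurrentGl n | ∃ (k : ℕ) (m : Fin k → ℕ), 1 ≤ k ∧ u = cycleElt n m} =
      glInvariants n ∧
    (4 ≤ n →
      Algebra.adjoin ℂ
          {u : UCurrentGl n |
            ∃ (k : ℕ) (m : Fin k → ℕ), 1 ≤ k ∧ Monotone m ∧ u = cycleElt n m} ≠
        glInvariants n) := by
  exact ⟨cycleAlgebra_eq_glInvariants n, fun hn => sortedCycleAlgebra_ne_glInvariants hn⟩
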